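/- A growth function is a continuous nondecreasing function $\Phi$ from $[0,\infty)$ onto itself. It satisfies the $\Delta_2$-condition if there is $K>1$ with $\Phi(2t)\le K\Phi(t)$ for all $t\ge 0$; a convex $\Phi$ satisfies the $\nabla_2$-condition if both $\Phi$ and its complementary function $\Psi(s)=\sup_{t\ge 0}\{ts-\Phi(t)\}$, $s\ge 0$, satisfy the $\Delta_2$-condition. The class $\mathscr U$ consists of the growth functions $\Phi$ such that $t\mapsto\Phi(t)/t$ is nondecreasing on $(0,\infty)$ and, for some $q\ge 1$ and $C>0$, $\Phi(st)\le Ct^q\Phi(s)$ for all $s>0$, $t\ge 1$. Let $\mathbb C_+=\{x+iy:\ y>0\}$ and, for $\alpha>-1$, $dV_\alpha(x+iy)=y^\alpha\,dx\,dy$ on $\mathbb C_+$. For a growth function $\Phi$, the Hardy-Orlicz space $H^{\Phi}(\mathbb C_+)$ is the space of holomorphic functions $f$ on $\mathbb C_+$ with $$\|f\|^{lux}_{H^\Phi}:=\sup_{y>0}\ \inf\Big\{\lambda>0:\int_{\mathbb R}\Phi\Big(\frac{|f(x+iy)|}{\lambda}\Big)dx\le 1\Big\}<\infty,$$ and the Bergman-Orlicz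 space $A^\Phi_\alpha(\mathbb C_+)$ is the space of holomorphic functions $f$ on $\mathbb C_+$ with $\int_{\mathbb C_+}\Phi(|f|)\,dV_\alpha<\infty$, endowed with $$\|f\|^{lux}_{\Phi,\alpha}:=\inf\Big\{\lambda>0:\int_{\mathbb C_+}\Phi\Big(\frac{|f(z)|}{\lambda}\Big)dV_\alpha(z)\le 1\Big\}.$$ **Theorem.** Let $\Phi_1$ and $\Phi_2$ be two $\mathcal C^1$ convex growth functions with $\Phi_2\in\mathscr U$, and let $\alpha>-1$. Assume that $\Phi_1$ satisfies the $\nabla_2$-condition and that $\Phi_2/\Phi_1$ is nondecreasing on $(0,\infty)$. Then $H^{\Phi_1}(\mathbb C_+)$ embeds continuously into $A_\alpha^{\Phi_2}(\mathbb C_+)$ (that is, $H^{\Phi_1}(\mathbb C_+)\subseteq A_\alpha^{\Phi_2}(\mathbb C_+)$ and there is a constant $C'>0$ with $\|f\|^{lux}_{\Phi_2,\alpha}\le C'\|f\|^{lux}_{H^{\Phi_1}}$ for all $f\in H^{\Phi_1}(\mathbb C_+)$) if and only if there exists a constant $C>0$ such that for all $t\in(0,\infty)$, $$\Phi_1^{-1}(t)\le\Phi_2^{-1}\big(Ct^{2+\alpha}\big).$$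 -/

import Mathlib

open MeasureTheory Set
open scoped ENNReal

noncomputable section

namespace HardyOrlicz

/-- A growth function: a continuous nondecreasing function from `[0, ∞)` onto itself
(the values of `Φ` at negative arguments are never used). -/
structure IsGrowthFunction (Φ : ℝ → ℝ) : Prop where
  continuousOn : ContinuousOn Φ (Ici 0)
  monotoneOn : MonotoneOn Φ (Ici 0)
  image_eq : Φ '' Ici 0 = Ici 0

/-- A `C¹` convex growth function; at `0` the derivative is the one-sided one. -/
structure IsC1ConvexGrowth (Φ : ℝ → ℝ) : Prop where
  growth : IsGrowthFunction Φ
  convexOn : ConvexOn ℝ (Ici 0) Φ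
  contDiffOn : ContDiffOn ℝ 1 Φ (Ici 0)

/-- `Φ` is of upper type `q`. -/
def IsUpperType (Φ : ℝ → ℝ) (q : ℝ) : Prop :=
  ∃ C : ℝ, 0 < C ∧ ∀ s t : ℝ, 0 < s → 1 ≤ t → Φ (s * t) ≤ C * t ^ q * Φ s

/-- The class `𝒰 = ⋃_{q ≥ 1} 𝒰^q`, where `𝒰^q` is the set of growth functions `Φ` of upper
type `q` for which `Φ(t)/t` is nondecreasing on `(0, ∞)`. -/
def ClassU (Φ : ℝ → ℝ) : Prop :=
  ∃ q : ℝ, 1 ≤ q ∧ IsGrowthFunction Φ ∧ IsUpperType Φ q ∧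
    MonotoneOn (fun t => Φ t / t) (Ioi 0)

/-- The complementary function `Ψ(s) = sup_{t ≥ 0} (t s - Φ(t))`, as an extended nonnegative
number: the supremum may be infinite, and it is nonnegative because the term `t = 0` is `0`. -/
def complementary (Φ : ℝ → ℝ) (s : ℝ) : ℝ≥0∞ :=
  ⨆ t ∈ Ici (0 : ℝ), ENNReal.ofReal (t * s - Φ t)

/-- The `Δ₂`-condition, for functions on `[0, ∞)` with values in `[0, ∞]`. -/
def Delta2 (F : ℝ → ℝ≥0∞) : Prop :=
  ∃ K : ℝ, 1 < K ∧ ∀ t : ℝ, 0 ≤ t → F (2 * t) ≤ ENNReal.ofReal K * F t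

/-- The `∇₂`-condition: `Φ` and its complementary function both satisfy `Δ₂`. -/
def Nabla2 (Φ : ℝ → ℝ) : Prop :=
  Delta2 (fun t => ENNReal.ofReal (Φ t)) ∧ Delta2 (complementary Φ)

/-- The inverse of `Φ : [0, ∞) → [0, ∞)`. -/
def growthInv (Φ : ℝ → ℝ) : ℝ → ℝ :=
  Function.invFunOn Φ (Ici 0)

/-- The open upper half-plane `ℂ₊`. -/
def upperHalf : Set ℂ := {z : ℂ | 0 < z.im}

/-- The modular `∫ Φ(|f| / l) dμ`. -/
def modular {X : Type*} [MeasurableSpace X] (Φ : ℝ → ℝ) (μ : Measure X) (f : X → ℂ) (l : ℝ) :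
    ℝ≥0∞ :=
  ∫⁻ x, ENNReal.ofReal (Φ (‖f x‖ / l)) ∂μ

/-- The Luxemburg (quasi-)norm `inf {l > 0 : ∫ Φ(|f| / l) dμ ≤ 1}`, equal to `∞` if there is
no such `l`. -/
def luxNorm {X : Type*} [MeasurableSpace X] (Φ : ℝ → ℝ) (μ : Measure X) (f : X → ℂ) : ℝ≥0∞ :=
  sInf (ENNReal.ofReal '' {l : ℝ | 0 < l ∧ modular Φ μ f l ≤ 1})

/-- The Hardy-Orlicz norm `sup_{y > 0} ‖f(· + i y)‖_{L^Φ(ℝ)}`. -/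
def hardyNorm (Φ : ℝ → ℝ) (f : ℂ → ℂ) : ℝ≥0∞ :=
  ⨆ y ∈ Ioi (0 : ℝ), luxNorm Φ volume (fun x : ℝ => f (x + y * Complex.I))

/-- The Hardy-Orlicz space `H^Φ(ℂ₊)`. Functions on `ℂ₊` are represented by functions on `ℂ`
whose values outside `ℂ₊` play no role. -/
def hardyOrlicz (Φ : ℝ → ℝ) : Set (ℂ → ℂ) :=
  {f | DifferentiableOn ℂ f upperHalf ∧ hardyNorm Φ f < ∞}

/-- The measure `dV_α(x + i y) = y^α dx dy` on `ℂ₊`. -/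
def weightedVolume (α : ℝ) : Measure ℂ :=
  (volume.restrict upperHalf).withDensity (fun z => ENNReal.ofReal (z.im ^ α))

/-- The Luxemburg (quasi-)norm of the Bergman-Orlicz space. -/
def bergmanNorm (α : ℝ) (Φ : ℝ → ℝ) (f : ℂ → ℂ) : ℝ≥0∞ :=
  luxNorm Φ (weightedVolume α) f

/-- The Bergman-Orlicz space `A_α^Φ(ℂ₊)`: holomorphic functions on `ℂ₊` with
`∫ Φ(|f|) dV_α < ∞`. -/
def bergmanOrlicz (α : ℝ) (Φ : ℝ → ℝ) : Set (ℂ → ℂ) :=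
  {f | DifferentiableOn ℂ f upperHalf ∧
    ∫⁻ z, ENNReal.ofReal (Φ ‖f z‖) ∂(weightedVolume α) < ∞}

/-- `H^{Φ₁}(ℂ₊)` embeds continuously into `A_α^{Φ₂}(ℂ₊)`: it is contained in it, and the
inclusion is bounded for the Luxemburg (quasi-)norms. -/
def EmbedsContinuously (Φ₁ Φ₂ : ℝ → ℝ) (α : ℝ) : Prop :=
  hardyOrlicz Φ₁ ⊆ bergmanOrlicz α Φ₂ ∧
    ∃ C : ℝ, 0 < C ∧ ∀ f ∈ hardyOrlicz Φ₁,
      bergmanNorm α Φ₂ f ≤ ENNReal.ofReal C * hardyNorm Φ₁ f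

end HardyOrlicz

end

/-!
The inequality between the inverse functions says that `Φ₂ u ≤ C Φ₁(u) ^ (2 + α)` for all `u > 0`
(`growthInv_le_iff`).

*Necessity* (`exists_le_rpow_of_embedsContinuously`). For `y = 1 / Φ₁ u` the function
`u y² / (z + i y)²` has bounded norm in `H^{Φ₁}`, because its modulus on horizontal lines is at most
a multiple of `u` times `y` times the Poisson kernel. It is comparable to `u` on the Carleson box of
side `y`, whose measure is a multiple of `y ^ (2 + α) = Φ₁(u) ^ (-(2 + α))`.

*Sufficiency* (`exists_modular_le`). Neither boundary values nor a maximal function are needed.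
If `f` has norm less than `1` in `H^{Φ₁}`, then `f(· + i ε)` is bounded on the half-plane by the
area mean value inequality (`exists_norm_le_of_lintegral_le`), so its modulus is at most the Poisson
integral `P g` of `g(t) = |f(t + i ε)|` (`enorm_le_poissonInt`), where `∫ Φ₁(g) ≤ 1`. Since
`P g(x + i y) ≤ ‖g‖₁ / (π y)`, the operator `P` maps `L¹(ℝ)` to weak `L^(2 + α)(V_α)`
(`weightedVolume_lt_poissonInt_le`). Truncating `g` at the level `l / 2` and using
`∫ g 1_{g > l / 2} ≤ (l / 2) / Φ₁(l / 2)` and the comparison of `Φ₂` with `Φ₁ ^ (2 + α)` gives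
`Φ₂(l) / l * V_α {P g > l} ≤ C Φ₁(l) / l² * ∫ g 1_{g > l / 2}`. Integrating in `l`
(`exists_lintegral_le_of_le_poissonInt`), the right side is at most a multiple of `∫ Φ₁(g)` because
of the Dini-type condition `∫₀ᵗ Φ₁(l) / l² dl ≤ C Φ₁(t) / t`, which is what `∇₂` provides
(`IsC1ConvexGrowth.exists_superlinear`, `lintegral_div_sq_le`). Finally `ε → 0` by Fatou's lemma.
-/

noncomputable section

namespace HardyOrlicz

/-! ### Growth functions -/

section Growth

variable {Φ : ℝ → ℝ}

lemma IsGrowthFunction.nonneg (h : IsGrowthFunction Φ) {t : ℝ} (ht : 0 ≤ t) : 0 ≤ Φ t := by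
  have : Φ t ∈ Φ '' Ici 0 := mem_image_of_mem _ ht
  rwa [h.image_eq] at this

lemma IsGrowthFunction.map_zero (h : IsGrowthFunction Φ) : Φ 0 = 0 := by
  have h0 : (0 : ℝ) ∈ Φ '' Ici 0 := by rw [h.image_eq]; exact self_mem_Ici
  obtain ⟨t, ht, h0⟩ := h0
  refine le_antisymm ?_ (h.nonneg le_rfl)
  exact (h.monotoneOn self_mem_Ici ht ht).trans h0.le

/-- A growth function satisfying the `Δ₂`-condition vanishes only at `0`: a zero `t > 0` would
make it vanish at all `2 ^ n * t`, hence identically. -/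
lemma IsGrowthFunction.pos_of_delta2 (h : IsGrowthFunction Φ)
    (hΔ : Delta2 (fun t => ENNReal.ofReal (Φ t))) {t : ℝ} (ht : 0 < t) : 0 < Φ t := by
  obtain ⟨K, hK, hd⟩ := hΔ
  by_contra hcon
  have h0 : Φ t ≤ 0 := not_lt.1 hcon
  have hn : ∀ n : ℕ, Φ (2 ^ n * t) ≤ 0 := by
    intro n
    induction n with
    | zero => simpa using h0
    | succ n ih =>
      have := hd (2 ^ n * t) (by positivity)
      beta_reduce at this
      rw [ENNReal.ofReal_of_nonpos ih, mul_zero, nonpos_iff_eq_zero, ENNReal.ofReal_eq_zero] at this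
      rw [pow_succ]
      convert this using 2
      ring
  have h1 : (1 : ℝ) ∈ Φ '' Ici 0 := by rw [h.image_eq]; simp
  obtain ⟨s, hs, h1⟩ := h1
  obtain ⟨n, hns⟩ := pow_unbounded_of_one_lt (s / t) (one_lt_two)
  have hle : s ≤ 2 ^ n * t := by
    rw [div_lt_iff₀ ht] at hns
    exact hns.le
  have := h.monotoneOn hs (mem_Ici.2 (by positivity)) hle
  linarith [hn n]

lemma IsGrowthFunction.pos_of_upperType (h : IsGrowthFunction Φ) {q : ℝ} (hq : IsUpperType Φ q)
    {t : ℝ} (ht : 0 < t) : 0 < Φ t := by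
  obtain ⟨C, hC, hq⟩ := hq
  by_contra hcon
  have h0 : Φ t = 0 := le_antisymm (not_lt.1 hcon) (h.nonneg ht.le)
  have h1 : (1 : ℝ) ∈ Φ '' Ici 0 := by rw [h.image_eq]; simp
  obtain ⟨s, hs, h1⟩ := h1
  rcases le_total s t with hst | hst
  · have := h.monotoneOn hs ht.le hst
    linarith
  · have := hq t (s / t) ht ((one_le_div ht).2 hst)
    rw [mul_div_cancel₀ s ht.ne', h0, h1] at this
    norm_num at this

lemma IsC1ConvexGrowth.map_mul_le (h : IsC1ConvexGrowth Φ) {a t : ℝ} (ha : 0 ≤ a) (ha1 : a ≤ 1)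
    (ht : 0 ≤ t) : Φ (a * t) ≤ a * Φ t := by
  have := h.convexOn.2 (self_mem_Ici (a := (0 : ℝ))) (mem_Ici.2 ht) (sub_nonneg.2 ha1) ha (by ring)
  simpa [h.growth.map_zero] using this

lemma IsC1ConvexGrowth.strictMonoOn (h : IsC1ConvexGrowth Φ) (hpos : ∀ t, 0 < t → 0 < Φ t) :
    StrictMonoOn Φ (Ici 0) := by
  intro s hs t ht hst
  have ht0 : 0 < t := lt_of_le_of_lt hs hst
  have := h.map_mul_le (div_nonneg hs ht0.le) ((div_le_one ht0).2 hst.le) ht0.le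
  rw [div_mul_cancel₀ s ht0.ne'] at this
  exact this.trans_lt (mul_lt_of_lt_one_left (hpos t ht0) ((div_lt_one ht0).2 hst))

lemma IsGrowthFunction.map_growthInv (h : IsGrowthFunction Φ) {t : ℝ} (ht : 0 ≤ t) :
    Φ (growthInv Φ t) = t :=
  Function.invFunOn_eq (by
    have : t ∈ Φ '' Ici 0 := by rw [h.image_eq]; exact ht
    exact this)

lemma IsGrowthFunction.growthInv_nonneg (h : IsGrowthFunction Φ) {t : ℝ} (ht : 0 ≤ t) :
    0 ≤ growthInv Φ t :=
  mem_Ici.1 <| Function.invFunOn_mem (f := Φ) (b := t) (by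
    have : t ∈ Φ '' Ici 0 := by rw [h.image_eq]; exact ht
    exact this)

/-- The comparison of the inverse functions, rewritten in terms of the functions themselves. -/
lemma growthInv_le_iff {Φ₁ Φ₂ : ℝ → ℝ} {C r : ℝ} (hC : 0 < C)
    (h₁ : IsGrowthFunction Φ₁) (h₂ : IsGrowthFunction Φ₂)
    (hs₁ : StrictMonoOn Φ₁ (Ici 0)) (hs₂ : StrictMonoOn Φ₂ (Ici 0)) :
    (∀ t : ℝ, 0 < t → growthInv Φ₁ t ≤ growthInv Φ₂ (C * t ^ r)) ↔
      ∀ u : ℝ, 0 < u → Φ₂ u ≤ C * Φ₁ u ^ r := by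
  constructor
  · intro h u hu
    have hpos : 0 < Φ₁ u := by
      rw [← h₁.map_zero]; exact hs₁ self_mem_Ici hu.le hu
    have hinv : growthInv Φ₁ (Φ₁ u) = u :=
      hs₁.injOn (h₁.growthInv_nonneg hpos.le) hu.le (h₁.map_growthInv hpos.le)
    have hv : 0 ≤ C * Φ₁ u ^ r := by positivity
    have := h (Φ₁ u) hpos
    rw [hinv] at this
    rw [← h₂.map_growthInv hv]
    exact h₂.monotoneOn hu.le (h₂.growthInv_nonneg hv) this
  · intro h t ht
    have hv : 0 ≤ C * t ^ r := by positivity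
    have hu : 0 < growthInv Φ₁ t := by
      refine lt_of_le_of_ne (h₁.growthInv_nonneg ht.le) fun h0 => ?_
      have := h₁.map_growthInv ht.le
      rw [← h0, h₁.map_zero] at this
      exact ht.ne this
    have := h _ hu
    rw [h₁.map_growthInv ht.le, ← h₂.map_growthInv hv] at this
    exact (hs₂.le_iff_le hu.le (h₂.growthInv_nonneg hv)).1 this

lemma complementary_le {s b : ℝ} (h : ∀ t, 0 ≤ t → t * s - Φ t ≤ b) :
    complementary Φ s ≤ ENNReal.ofReal b :=
  iSup₂_le fun t ht => ENNReal.ofReal_le_ofReal (h t ht)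

lemma le_complementary {s t : ℝ} (ht : 0 ≤ t) :
    ENNReal.ofReal (t * s - Φ t) ≤ complementary Φ s :=
  le_iSup₂ (f := fun t (_ : t ∈ Ici (0 : ℝ)) => ENNReal.ofReal (t * s - Φ t)) t ht

/-- The `Δ₂`-condition for the complementary function makes `Φ` grow faster than linearly.
With `s` the slope of a supporting line of `Φ` at `τ`, the complementary function satisfies
`Ψ s = s τ - Φ τ`, so Young's inequality for `t = K τ / 2` and `2 s` gives
`Φ t ≥ 2 s t - Ψ (2 s) ≥ K s τ - K Ψ s = K Φ τ`. -/
lemma IsC1ConvexGrowth.exists_superlinear (h : IsC1ConvexGrowth Φ)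
    (hΔ : Delta2 (complementary Φ)) :
    ∃ a : ℝ, 2 ≤ a ∧ ∀ τ : ℝ, 0 < τ → 2 * a * Φ τ ≤ Φ (a * τ) := by
  obtain ⟨K₀, hK₀, hd⟩ := hΔ
  set K := max K₀ 4
  have hK4 : 4 ≤ K := le_max_right _ _
  refine ⟨K / 2, by linarith, fun τ hτ => ?_⟩
  have hint : τ ∈ interior (Ici (0 : ℝ)) := by rw [interior_Ici]; exact hτ
  have hdiff : DifferentiableAt ℝ Φ τ :=
    (h.contDiffOn.differentiableOn (by norm_num)).differentiableAt
      (mem_interior_iff_mem_nhds.1 hint)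
  set s := deriv Φ τ
  have hsupp : ∀ t, 0 ≤ t → Φ τ + s * (t - τ) ≤ Φ t := by
    intro t ht
    rcases lt_trichotomy t τ with htτ | rfl | htτ
    · have := h.convexOn.slope_le_deriv (mem_Ici.2 ht) hτ.le htτ hdiff
      rw [slope_def_field, div_le_iff₀ (by linarith)] at this
      linarith
    · simp
    · have := h.convexOn.deriv_le_slope hτ.le (mem_Ici.2 ht) htτ hdiff
      rw [slope_def_field, le_div_iff₀ (by linarith)] at this
      linarith
  have hs : 0 ≤ s := by
    have := h.convexOn.slope_le_deriv (self_mem_Ici (a := (0 : ℝ))) hτ.le hτ hdiff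
    rw [slope_def_field, h.growth.map_zero] at this
    exact le_trans (div_nonneg (by simpa using h.growth.nonneg hτ.le) (by linarith)) this
  have h1 : complementary Φ s ≤ ENNReal.ofReal (s * τ - Φ τ) :=
    complementary_le fun t ht => by linarith [hsupp t ht]
  have hΨ : 0 ≤ s * τ - Φ τ := by
    have := hsupp 0 le_rfl
    rw [h.growth.map_zero] at this
    linarith
  have h2 : ENNReal.ofReal (K / 2 * τ * (2 * s) - Φ (K / 2 * τ)) ≤
      ENNReal.ofReal (K * (s * τ - Φ τ)) := by
    rw [ENNReal.ofReal_mul (by linarith)]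
    refine (le_complementary (by positivity)).trans ((hd s hs).trans ?_)
    gcongr
    exact le_max_left _ _
  rw [ENNReal.ofReal_le_ofReal_iff (by positivity)] at h2
  linarith

/-- The Dini-type condition equivalent to `∇₂`: it is what lets the Marcinkiewicz argument start
from `L¹`. The interval `(0, t]` is cut at the points `t / a ^ k`, where `Φ (t / a ^ k)` is at most
`(2 a) ^ (-k) Φ t`. -/
lemma lintegral_div_sq_le {a : ℝ} (h : IsGrowthFunction Φ) (ha : 2 ≤ a)
    (hsup : ∀ τ : ℝ, 0 < τ → 2 * a * Φ τ ≤ Φ (a * τ)) {t : ℝ} (ht : 0 < t) :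
    ∫⁻ l in Ioc 0 t, ENNReal.ofReal (Φ l / l ^ 2) ≤ ENNReal.ofReal (2 * a ^ 2 * (Φ t / t)) := by
  have ha0 : 0 < a := by linarith
  have hk : ∀ k : ℕ, Φ (t / a ^ k) ≤ (2 * a)⁻¹ ^ k * Φ t := by
    intro k
    induction k with
    | zero => simp
    | succ k ih =>
      have h1 := hsup (t / a ^ (k + 1)) (by positivity)
      have h2 : a * (t / a ^ (k + 1)) = t / a ^ k := by rw [pow_succ]; field_simp
      rw [h2] at h1
      have h3 := h1.trans ih
      rw [← le_div_iff₀' (by positivity)] at h3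
      refine h3.trans (le_of_eq ?_)
      rw [pow_succ]
      field_simp
  have hsub : Ioc 0 t ⊆ ⋃ k : ℕ, Ioc (t / a ^ (k + 1)) (t / a ^ k) := by
    intro l hl
    obtain ⟨n, hn1, hn2⟩ := exists_nat_pow_near_of_lt_one (x := l / t) (y := a⁻¹)
      (div_pos hl.1 ht) ((div_le_one ht).2 hl.2) (by positivity) (inv_lt_one_of_one_lt₀ (by linarith))
    refine mem_iUnion.2 ⟨n, ?_, ?_⟩
    · rw [lt_div_iff₀ ht, inv_pow] at hn1
      rwa [div_eq_inv_mul]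
    · rw [div_le_iff₀ ht, inv_pow] at hn2
      rwa [div_eq_inv_mul]
  have hpiece : ∀ k : ℕ, ∫⁻ l in Ioc (t / a ^ (k + 1)) (t / a ^ k), ENNReal.ofReal (Φ l / l ^ 2) ≤
      ENNReal.ofReal (a ^ 2 * (Φ t / t) * (1 / 2) ^ k) := by
    intro k
    calc ∫⁻ l in Ioc (t / a ^ (k + 1)) (t / a ^ k), ENNReal.ofReal (Φ l / l ^ 2)
        ≤ ∫⁻ _ in Ioc (t / a ^ (k + 1)) (t / a ^ k),
            ENNReal.ofReal ((2 * a)⁻¹ ^ k * Φ t / (t / a ^ (k + 1)) ^ 2) := by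
          refine setLIntegral_mono (by fun_prop) fun l hl => ENNReal.ofReal_le_ofReal ?_
          have hp : 0 < t / a ^ (k + 1) := by positivity
          have hl0 : 0 < l := hp.trans hl.1
          have h1 : Φ l ≤ (2 * a)⁻¹ ^ k * Φ t :=
            (h.monotoneOn hl0.le (mem_Ici.2 (by positivity)) hl.2).trans (hk k)
          have := h.nonneg hl0.le
          have := this.trans h1
          gcongr
          exact hl.1.le
      _ = ENNReal.ofReal ((2 * a)⁻¹ ^ k * Φ t / (t / a ^ (k + 1)) ^ 2 *
            (t / a ^ k - t / a ^ (k + 1))) := by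
          have := h.nonneg ht.le
          rw [setLIntegral_const, Real.volume_Ioc, ← ENNReal.ofReal_mul (by positivity)]
      _ ≤ _ := by
          have := h.nonneg ht.le
          refine ENNReal.ofReal_le_ofReal ?_
          calc (2 * a)⁻¹ ^ k * Φ t / (t / a ^ (k + 1)) ^ 2 * (t / a ^ k - t / a ^ (k + 1))
              ≤ (2 * a)⁻¹ ^ k * Φ t / (t / a ^ (k + 1)) ^ 2 * (t / a ^ k) := by
                gcongr
                have : 0 < t / a ^ (k + 1) := by positivity
                linarith
            _ = _ := by
                rw [mul_inv, mul_pow, inv_pow, inv_pow, one_div, inv_pow]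
                field_simp
                ring
  calc ∫⁻ l in Ioc 0 t, ENNReal.ofReal (Φ l / l ^ 2)
      ≤ ∫⁻ l in ⋃ k : ℕ, Ioc (t / a ^ (k + 1)) (t / a ^ k), ENNReal.ofReal (Φ l / l ^ 2) :=
        lintegral_mono_set hsub
    _ ≤ ∑' k : ℕ, ∫⁻ l in Ioc (t / a ^ (k + 1)) (t / a ^ k), ENNReal.ofReal (Φ l / l ^ 2) :=
        lintegral_iUnion_le _ _
    _ ≤ ∑' k : ℕ, ENNReal.ofReal (a ^ 2 * (Φ t / t) * (1 / 2) ^ k) := ENNReal.tsum_le_tsum hpiece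
    _ = ENNReal.ofReal (2 * a ^ 2 * (Φ t / t)) := by
        have := h.nonneg ht.le
        rw [← ENNReal.ofReal_tsum_of_nonneg (fun k => by positivity)
          (summable_geometric_two.mul_left _), tsum_mul_left, tsum_geometric_two]
        congr 1
        ring

end Growth

/-! ### The Poisson formula in the half-plane -/

/-- The Poisson kernel `y / (π (x² + y²))` of the upper half-plane. -/
def poissonKer (y x : ℝ) : ℝ := Real.pi⁻¹ * (y / (x ^ 2 + y ^ 2))

/-- The Poisson integral, at the point `x + i y`, of a function `g ≥ 0` on the real line. -/
def poissonInt (g : ℝ → ℝ≥0∞) (x y : ℝ) : ℝ≥0∞ :=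
  ∫⁻ t, ENNReal.ofReal (poissonKer y (x - t)) * g t

lemma continuous_poissonKer {y : ℝ} (hy : 0 < y) : Continuous (poissonKer y) := by
  unfold poissonKer
  refine continuous_const.mul (continuous_const.div (by fun_prop) fun x => ?_)
  positivity

lemma measurable_poissonKer : Measurable (fun p : ℝ × ℝ => poissonKer p.1 p.2) := by
  unfold poissonKer
  fun_prop

lemma poissonKer_nonneg {y : ℝ} (hy : 0 < y) (x : ℝ) : 0 ≤ poissonKer y x := by
  unfold poissonKer
  positivity

lemma poissonKer_le {y : ℝ} (hy : 0 < y) (x : ℝ) : poissonKer y x ≤ (Real.pi * y)⁻¹ := by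
  unfold poissonKer
  rw [mul_inv]
  gcongr
  rw [div_le_iff₀ (by positivity), inv_mul_eq_div, le_div_iff₀ hy]
  nlinarith [sq_nonneg x]

lemma poissonKer_eq {y : ℝ} (hy : 0 < y) (x : ℝ) :
    poissonKer y x = (Real.pi * y)⁻¹ * (1 + (x / y) ^ 2)⁻¹ := by
  unfold poissonKer
  have : x ^ 2 + y ^ 2 ≠ 0 := by positivity
  have : 1 + (x / y) ^ 2 ≠ 0 := by positivity
  field_simp
  ring

lemma integrable_poissonKer {y : ℝ} (hy : 0 < y) : Integrable (poissonKer y) := by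
  rw [show poissonKer y = fun x => (Real.pi * y)⁻¹ * (1 + (x / y) ^ 2)⁻¹ from
    funext (poissonKer_eq hy)]
  exact (integrable_inv_one_add_sq.comp_div hy.ne').const_mul _

lemma integral_poissonKer {y : ℝ} (hy : 0 < y) : ∫ x, poissonKer y x = 1 := by
  simp_rw [poissonKer_eq hy]
  rw [integral_const_mul, Measure.integral_comp_div (fun x => (1 + x ^ 2)⁻¹) y,
    integral_univ_inv_one_add_sq, abs_of_pos hy, smul_eq_mul]
  have := Real.pi_pos
  field_simp

lemma lintegral_poissonKer {y : ℝ} (hy : 0 < y) :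
    ∫⁻ x, ENNReal.ofReal (poissonKer y x) = 1 := by
  rw [← ofReal_integral_eq_lintegral_ofReal (integrable_poissonKer hy)
    (.of_forall (poissonKer_nonneg hy)), integral_poissonKer hy, ENNReal.ofReal_one]

lemma measurable_poissonInt {g : ℝ → ℝ≥0∞} (hg : Measurable g) :
    Measurable (fun p : ℝ × ℝ => poissonInt g p.1 p.2) := by
  unfold poissonInt
  refine Measurable.lintegral_prod_right'
    (f := fun q : (ℝ × ℝ) × ℝ => ENNReal.ofReal (poissonKer q.1.2 (q.1.1 - q.2)) * g q.2) ?_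
  refine Measurable.mul (ENNReal.measurable_ofReal.comp ?_) (hg.comp measurable_snd)
  have hm : Measurable fun q : (ℝ × ℝ) × ℝ => (q.1.2, q.1.1 - q.2) := by fun_prop
  exact measurable_poissonKer.comp hm

lemma continuous_comp_ofReal {F : ℂ → ℂ} {U : Set ℂ} (hU : IsOpen U)
    (hUsub : ∀ z : ℂ, 0 ≤ z.im → z ∈ U) (hF : DifferentiableOn ℂ F U) :
    Continuous fun t : ℝ => F t := by
  refine continuous_iff_continuousAt.2 fun t => ?_
  have h1 : ContinuousAt F (t : ℂ) :=
    (hF.differentiableAt (hU.mem_nhds (hUsub t (by simp)))).continuousAt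
  exact ContinuousAt.comp (f := fun t : ℝ => (t : ℂ)) h1 Complex.continuous_ofReal.continuousAt

/-- The difference quotient `(F ζ - F z) / ((ζ - z) (ζ - z̄))` is holomorphic near the closed
half-plane and decays quadratically, so by Cauchy's theorem on large rectangles its integral over
the real line vanishes. -/
lemma integral_poissonKer_smul_sub {F : ℂ → ℂ} {U : Set ℂ} {B : ℝ} (hU : IsOpen U)
    (hUsub : ∀ z : ℂ, 0 ≤ z.im → z ∈ U) (hF : DifferentiableOn ℂ F U)
    (hB : ∀ z : ℂ, 0 ≤ z.im → ‖F z‖ ≤ B) {x y : ℝ} (hy : 0 < y) :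
    ∫ t : ℝ, poissonKer y (x - t) • (F t - F (x + y * Complex.I)) = 0 := by
  set z : ℂ := x + y * Complex.I with hz
  have hzre : z.re = x := by simp [hz]
  have hzim : z.im = y := by simp [hz]
  have hB0 : 0 ≤ B := (norm_nonneg _).trans (hB 0 le_rfl)
  have hzU : U ∈ nhds z := hU.mem_nhds (hUsub z (by rw [hzim]; exact hy.le))
  set w : ℂ := (starRingEnd ℂ) z with hw
  have hwre : w.re = x := by simp [hw, hzre]
  have hwim : w.im = -y := by simp [hw, hzim]
  have hne : ∀ ζ : ℂ, 0 ≤ ζ.im → ζ - w ≠ 0 := by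
    intro ζ hζ h0
    have := congrArg Complex.im h0
    rw [Complex.sub_im, hwim, Complex.zero_im] at this
    linarith
  set H : ℂ → ℂ := fun ζ => dslope F z ζ / (ζ - w) with hH
  have hHd : DifferentiableOn ℂ H {ζ | 0 ≤ ζ.im} := by
    refine DifferentiableOn.div ?_ (by fun_prop) hne
    exact ((Complex.differentiableOn_dslope hzU).2 hF).mono fun ζ hζ => hUsub ζ hζ
  have hdecay : ∀ R : ℝ, 0 < R → ∀ ζ : ℂ, 0 ≤ ζ.im → R / 2 ≤ ‖ζ - z‖ → R / 2 ≤ ‖ζ - w‖ →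
      ‖H ζ‖ ≤ 8 * B / R ^ 2 := by
    intro R hR ζ hζ h1 h2
    have hζz : ζ ≠ z := by
      rintro rfl
      rw [sub_self, norm_zero] at h1
      linarith
    have h3 : ‖F ζ - F z‖ ≤ B + B :=
      (norm_sub_le _ _).trans (add_le_add (hB ζ hζ) (hB z (by rw [hzim]; exact hy.le)))
    rw [hH]
    simp only
    rw [dslope_of_ne _ hζz, slope_def_field, norm_div, norm_div]
    calc ‖F ζ - F z‖ / ‖ζ - z‖ / ‖ζ - w‖ ≤ (B + B) / (R / 2) / (R / 2) := by gcongr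
      _ = _ := by field_simp; ring
  have hline : ∀ t : ℝ, H t = (Real.pi / y) • (poissonKer y (x - t) • (F t - F z)) := by
    intro t
    have htz : (t : ℂ) ≠ z := by
      intro h
      have := congrArg Complex.im h
      rw [hzim, Complex.ofReal_im] at this
      linarith
    have hprod : ((t : ℂ) - z) * (t - w) = (((x - t) ^ 2 + y ^ 2 : ℝ) : ℂ) := by
      apply Complex.ext
      · simp [pow_two, hzre, hzim, hwre, hwim]; ring
      · simp [pow_two, hzre, hzim, hwre, hwim]; ring
    have hπ := Real.pi_pos
    rw [hH]
    simp only
    rw [dslope_of_ne _ htz, slope_def_field, div_div, hprod, smul_smul]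
    have : Real.pi / y * poissonKer y (x - t) = ((x - t) ^ 2 + y ^ 2)⁻¹ := by
      unfold poissonKer
      field_simp
    rw [this, Complex.real_smul, Complex.ofReal_inv, div_eq_inv_mul]
  have hFc : Continuous fun t : ℝ => F t := continuous_comp_ofReal hU hUsub hF
  have hint : Integrable fun t : ℝ => poissonKer y (x - t) • (F t - F z) := by
    refine Integrable.mono' (g := fun t => poissonKer y (x - t) * (B + B))
      (((integrable_poissonKer hy).comp_sub_left x).mul_const _) ?_ (.of_forall fun t => ?_)
    · exact (((continuous_poissonKer hy).comp (continuous_const.sub continuous_id)).smul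
        (hFc.sub continuous_const)).aestronglyMeasurable
    · rw [norm_smul, Real.norm_of_nonneg (poissonKer_nonneg hy _)]
      have := poissonKer_nonneg hy (x - t)
      gcongr
      exact (norm_sub_le _ _).trans
        (add_le_add (hB _ (by simp)) (hB z (by rw [hzim]; exact hy.le)))
  have hHint : Integrable fun t : ℝ => H t := by
    rw [show (fun t : ℝ => H t) = fun t : ℝ =>
      (Real.pi / y) • (poissonKer y (x - t) • (F t - F z)) from funext hline]
    exact hint.smul (Real.pi / y)
  have hrect : ∀ R : ℝ, 2 * y ≤ R → ‖∫ t in (x - R)..(x + R), H t‖ ≤ 32 * B / R := by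
    intro R hR
    have hR0 : 0 < R := by linarith
    have hC := Complex.integral_boundary_rect_eq_zero_of_differentiableOn H
      ⟨x - R, 0⟩ ⟨x + R, R⟩ (hHd.mono fun ζ hζ => by
        have := hζ.2
        simp only [mem_preimage] at this
        rw [uIcc_of_le hR0.le] at this
        exact this.1)
    simp only [Complex.ofReal_zero, zero_mul, add_zero] at hC
    have htop : ‖∫ t in (x - R)..(x + R), H (t + R * Complex.I)‖ ≤
        8 * B / R ^ 2 * |x + R - (x - R)| := by
      refine intervalIntegral.norm_integral_le_of_norm_le_const fun t _ => hdecay R hR0 _ ?_ ?_ ?_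
      · simp [hR0.le]
      · refine le_trans ?_ (Complex.abs_im_le_norm _)
        simp only [Complex.sub_im, Complex.add_im, Complex.ofReal_im, Complex.mul_im,
          Complex.ofReal_re, Complex.I_im, Complex.I_re, hzim]
        rw [abs_of_nonneg (by linarith)]
        linarith
      · refine le_trans ?_ (Complex.abs_im_le_norm _)
        simp only [Complex.sub_im, Complex.add_im, Complex.ofReal_im, Complex.mul_im,
          Complex.ofReal_re, Complex.I_im, Complex.I_re, hwim]
        rw [abs_of_nonneg (by linarith)]
        linarith
    have hside : ∀ b : ℝ, |b - x| = R → ‖∫ t in (0 : ℝ)..R, H (b + t * Complex.I)‖ ≤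
        8 * B / R ^ 2 * |R - 0| := by
      intro b hb
      refine intervalIntegral.norm_integral_le_of_norm_le_const fun t ht => hdecay R hR0 _ ?_ ?_ ?_
      · rw [uIoc_of_le hR0.le] at ht
        simpa using ht.1.le
      · refine le_trans ?_ (Complex.abs_re_le_norm _)
        simp only [Complex.sub_re, Complex.add_re, Complex.ofReal_re, Complex.mul_re,
          Complex.ofReal_im, Complex.I_im, Complex.I_re, hzre]
        ring_nf at hb ⊢
        rw [hb]
        linarith
      · refine le_trans ?_ (Complex.abs_re_le_norm _)
        simp only [Complex.sub_re, Complex.add_re, Complex.ofReal_re, Complex.mul_re,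
          Complex.ofReal_im, Complex.I_im, Complex.I_re, hwre]
        ring_nf at hb ⊢
        rw [hb]
        linarith
    have hr := hside (x + R) (by rw [add_sub_cancel_left, abs_of_pos hR0])
    have hl := hside (x - R) (by rw [sub_sub_cancel_left, abs_neg, abs_of_pos hR0])
    have heq : ∫ t in (x - R)..(x + R), H t =
        (∫ t in (x - R)..(x + R), H (t + R * Complex.I)) -
        Complex.I • (∫ t in (0 : ℝ)..R, H ((x + R : ℝ) + t * Complex.I)) +
        Complex.I • (∫ t in (0 : ℝ)..R, H ((x - R : ℝ) + t * Complex.I)) := by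
      linear_combination hC
    rw [heq]
    rw [abs_of_pos (by linarith)] at htop hr hl
    calc _ ≤ 8 * B / R ^ 2 * (x + R - (x - R)) + 8 * B / R ^ 2 * (R - 0) +
          8 * B / R ^ 2 * (R - 0) := by
          refine (norm_add_le _ _).trans (add_le_add ((norm_sub_le _ _).trans
            (add_le_add htop ?_)) ?_)
          · rwa [norm_smul, Complex.norm_I, one_mul]
          · rwa [norm_smul, Complex.norm_I, one_mul]
      _ = 32 * B / R := by field_simp; ring
  have hlim : Filter.Tendsto (fun R : ℝ => ∫ t in (x - R)..(x + R), H t) Filter.atTop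
      (nhds (∫ t : ℝ, H t)) :=
    intervalIntegral_tendsto_integral hHint
      (Filter.tendsto_atBot_add_const_left _ x Filter.tendsto_neg_atTop_atBot |>.congr
        fun R => by ring)
      (Filter.tendsto_atTop_add_const_left _ x Filter.tendsto_id)
  have hlim0 : Filter.Tendsto (fun R : ℝ => ∫ t in (x - R)..(x + R), H t) Filter.atTop
      (nhds 0) := by
    refine squeeze_zero_norm' (a := fun R => 32 * B / R) ?_
      (Filter.Tendsto.const_div_atTop Filter.tendsto_id _)
    filter_upwards [Filter.eventually_ge_atTop (2 * y)] with R hR using hrect R hR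
  have h0 := tendsto_nhds_unique hlim hlim0
  simp_rw [hline] at h0
  rw [integral_smul] at h0
  have hπ := Real.pi_pos
  exact (smul_eq_zero.1 h0).resolve_left (by positivity)

/-- The modulus of a bounded holomorphic function is at most the Poisson integral of its boundary
modulus. -/
lemma enorm_le_poissonInt {F : ℂ → ℂ} {U : Set ℂ} {B : ℝ} (hU : IsOpen U)
    (hUsub : ∀ z : ℂ, 0 ≤ z.im → z ∈ U) (hF : DifferentiableOn ℂ F U)
    (hB : ∀ z : ℂ, 0 ≤ z.im → ‖F z‖ ≤ B) {x y : ℝ} (hy : 0 < y) :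
    ‖F (x + y * Complex.I)‖ₑ ≤ poissonInt (fun t => ‖F t‖ₑ) x y := by
  have h0 := integral_poissonKer_smul_sub hU hUsub hF hB (x := x) hy
  set v := F (x + y * Complex.I)
  have hPi := (integrable_poissonKer hy).comp_sub_left x
  have hFc : Continuous fun t : ℝ => F t := continuous_comp_ofReal hU hUsub hF
  have hi1 : Integrable fun t : ℝ => poissonKer y (x - t) • F t :=
    hPi.smul_bdd B hFc.aestronglyMeasurable
      (.of_forall fun t => hB _ (by simp))
  have hi2 : Integrable fun t : ℝ => poissonKer y (x - t) • v := hPi.smul_const v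
  simp_rw [smul_sub] at h0
  rw [integral_sub hi1 hi2, integral_smul_const, integral_sub_left_eq_self (poissonKer y),
    integral_poissonKer hy, one_smul, sub_eq_zero] at h0
  rw [← h0]
  refine (enorm_integral_le_lintegral_enorm _).trans (lintegral_mono fun t => ?_)
  rw [enorm_smul, Real.enorm_of_nonneg (poissonKer_nonneg hy _)]

/-! ### Area means of holomorphic functions -/

lemma enorm_le_lintegral_circle {f : ℂ → ℂ} {z : ℂ} {r : ℝ} (hr : 0 < r)
    (hf : DifferentiableOn ℂ f (Metric.closedBall z r)) :
    ENNReal.ofReal (2 * Real.pi) * ‖f z‖ₑ ≤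
      ∫⁻ θ in Ioo (-Real.pi) Real.pi, ‖f (circleMap z r θ)‖ₑ := by
  have hπ := Real.pi_pos
  have hd : DiffContOnCl ℂ f (Metric.ball z |r|) := by
    rw [abs_of_pos hr]
    exact hf.diffContOnCl_ball subset_rfl
  have h1 := hd.circleAverage
  rw [Real.circleAverage_def, inv_smul_eq_iff₀ (by positivity)] at h1
  have hper : Function.Periodic (fun θ => f (circleMap z r θ)) (2 * Real.pi) :=
    (periodic_circleMap z r).comp f
  have h2 := hper.intervalIntegral_add_eq 0 (-Real.pi)
  rw [zero_add, h1, show -Real.pi + 2 * Real.pi = Real.pi by ring,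
    intervalIntegral.integral_of_le (by linarith)] at h2
  have h3 : ENNReal.ofReal (2 * Real.pi) * ‖f z‖ₑ = ‖(2 * Real.pi) • f z‖ₑ := by
    rw [enorm_smul, Real.enorm_of_nonneg (by positivity)]
  rw [h3, h2, restrict_Ioo_eq_restrict_Ioc]
  exact enorm_integral_le_lintegral_enorm _

/-- The area form of the mean value inequality, with a constant that is not the best one. -/
lemma enorm_le_lintegral_ball {f : ℂ → ℂ} {z : ℂ} {r : ℝ} (hr : 0 < r)
    (hf : DifferentiableOn ℂ f (Metric.closedBall z r)) :
    ENNReal.ofReal (r ^ 2) * ‖f z‖ₑ ≤ ∫⁻ w in Metric.ball z r, ‖f w‖ₑ := by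
  have hπ := Real.pi_pos
  set G : ℂ → ℝ≥0∞ := (Metric.ball z r).indicator (fun w => ‖f w‖ₑ) with hG
  have hGm : Measurable G := by
    classical
    rw [hG, ← piecewise_eq_indicator]
    exact (hf.continuousOn.mono Metric.ball_subset_closedBall).enorm.measurable_piecewise
      continuousOn_const Metric.isOpen_ball.measurableSet
  rw [← lintegral_indicator Metric.isOpen_ball.measurableSet,
    ← lintegral_add_left_eq_self _ z, ← Complex.lintegral_comp_polarCoord_symm]
  have htarget : polarCoord.target = Ioi (0 : ℝ) ×ˢ Ioo (-Real.pi) Real.pi := rfl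
  have hsymm : ∀ p : ℝ × ℝ, z + Complex.polarCoord.symm p = circleMap z p.1 p.2 := by
    intro p
    rw [Complex.polarCoord_symm_apply, circleMap, Complex.exp_mul_I, Complex.ofReal_cos,
      Complex.ofReal_sin]
  simp_rw [← hG, hsymm]
  have hmeas : Measurable fun p : ℝ × ℝ => ENNReal.ofReal p.1 • G (circleMap z p.1 p.2) := by
    refine Measurable.smul (ENNReal.measurable_ofReal.comp measurable_fst) (hGm.comp ?_)
    unfold circleMap
    fun_prop
  rw [htarget, Measure.volume_eq_prod, ← Measure.prod_restrict, lintegral_prod _ hmeas.aemeasurable]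
  calc ENNReal.ofReal (r ^ 2) * ‖f z‖ₑ
      ≤ ∫⁻ _ in Ioo (r / 2) r, ENNReal.ofReal (r / 2) *
          (ENNReal.ofReal (2 * Real.pi) * ‖f z‖ₑ) := by
        rw [setLIntegral_const, Real.volume_Ioo, sub_half, mul_right_comm, ← mul_assoc,
          ← ENNReal.ofReal_mul (by positivity), ← ENNReal.ofReal_mul (by positivity)]
        gcongr
        nlinarith [Real.pi_gt_three, sq_nonneg r]
    _ ≤ ∫⁻ ρ in Ioo (r / 2) r, ∫⁻ θ in Ioo (-Real.pi) Real.pi,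
          ENNReal.ofReal ρ • G (circleMap z ρ θ) := by
        refine setLIntegral_mono' measurableSet_Ioo fun ρ hρ => ?_
        have hρ0 : 0 < ρ := by linarith [hρ.1]
        simp_rw [smul_eq_mul]
        rw [lintegral_const_mul' _ _ ENNReal.ofReal_ne_top]
        gcongr
        · exact hρ.1.le
        refine (enorm_le_lintegral_circle hρ0
          (hf.mono (Metric.closedBall_subset_closedBall hρ.2.le))).trans ?_
        refine lintegral_mono fun θ => ?_
        rw [hG, indicator_of_mem]
        rw [Metric.mem_ball, dist_eq_norm, circleMap_sub_center, norm_circleMap_zero,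
          abs_of_pos hρ0]
        exact hρ.2
    _ ≤ _ := lintegral_mono_set fun ρ hρ => by
        have : r / 2 < ρ := hρ.1
        exact mem_Ioi.2 (by linarith)

/-! ### The weighted measure on the half-plane -/

instance instSFiniteWeightedVolume (α : ℝ) : SFinite (weightedVolume α) := by
  unfold weightedVolume
  infer_instance

lemma measurableSet_upperHalf : MeasurableSet upperHalf :=
  measurableSet_lt measurable_const Complex.measurable_im

lemma ae_weightedVolume_im_pos (α : ℝ) : ∀ᵐ z ∂(weightedVolume α), 0 < z.im :=
  (withDensity_absolutelyContinuous _ _).ae_le (ae_restrict_mem measurableSet_upperHalf)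

lemma lintegral_weightedVolume (α : ℝ) {F : ℂ → ℝ≥0∞} (hF : Measurable F) :
    ∫⁻ z, F z ∂(weightedVolume α) =
      ∫⁻ y in Ioi (0 : ℝ), ENNReal.ofReal (y ^ α) * ∫⁻ x : ℝ, F (x + y * Complex.I) := by
  have hd : Measurable fun z : ℂ => ENNReal.ofReal (z.im ^ α) :=
    ENNReal.measurable_ofReal.comp (Complex.measurable_im.pow_const α)
  have hm : Measurable (upperHalf.indicator ((fun z : ℂ => ENNReal.ofReal (z.im ^ α)) * F)) :=
    (hd.mul hF).indicator measurableSet_upperHalf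
  unfold weightedVolume
  rw [lintegral_withDensity_eq_lintegral_mul _ hd hF,
    ← lintegral_indicator measurableSet_upperHalf,
    ← (Complex.volume_preserving_equiv_real_prod.symm).lintegral_comp hm,
    Measure.volume_eq_prod, lintegral_prod_symm' (fun p => upperHalf.indicator _
      (Complex.measurableEquivRealProd.symm p)) (hm.comp (MeasurableEquiv.measurable _)),
    ← lintegral_indicator measurableSet_Ioi]
  refine lintegral_congr fun y => ?_
  have hxy : ∀ x : ℝ, Complex.measurableEquivRealProd.symm (x, y) = x + y * Complex.I := fun x => by
    apply Complex.ext <;> simp [Complex.measurableEquivRealProd]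
  simp_rw [hxy]
  by_cases hy : 0 < y
  · rw [indicator_of_mem (mem_Ioi.2 hy),
      ← lintegral_const_mul' _ _ ENNReal.ofReal_ne_top]
    refine lintegral_congr fun x => ?_
    rw [indicator_of_mem]
    · simp
    · simpa [upperHalf] using hy
  · rw [indicator_of_notMem (by simpa using hy)]
    refine (lintegral_congr fun x => ?_).trans lintegral_zero
    rw [indicator_of_notMem]
    simpa [upperHalf] using hy

lemma lintegral_rpow_Ioo {α Y : ℝ} (hα : -1 < α) (hY : 0 < Y) :
    ∫⁻ y in Ioo 0 Y, ENNReal.ofReal (y ^ α) = ENNReal.ofReal (Y ^ (α + 1) / (α + 1)) := by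
  rw [← ofReal_integral_eq_lintegral_ofReal
      ((intervalIntegral.integrableOn_Ioo_rpow_iff hY).2 hα)
      ((ae_restrict_mem measurableSet_Ioo).mono fun y hy => Real.rpow_nonneg hy.1.le _),
    ← integral_Ioc_eq_integral_Ioo, ← intervalIntegral.integral_of_le hY.le,
    integral_rpow (Or.inl hα), Real.zero_rpow (by linarith), sub_zero]

/-! ### The weak type estimate for the Poisson integral -/

lemma poissonInt_le {g : ℝ → ℝ≥0∞} {x y : ℝ} (hy : 0 < y) :
    poissonInt g x y ≤ ENNReal.ofReal (Real.pi * y)⁻¹ * ∫⁻ t, g t := by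
  unfold poissonInt
  rw [← lintegral_const_mul' _ _ ENNReal.ofReal_ne_top]
  refine lintegral_mono fun t => ?_
  gcongr
  exact poissonKer_le hy _

lemma lintegral_poissonInt {g : ℝ → ℝ≥0∞} (hg : Measurable g) {y : ℝ} (hy : 0 < y) :
    ∫⁻ x, poissonInt g x y = ∫⁻ t, g t := by
  unfold poissonInt
  have hm : Measurable fun p : ℝ × ℝ => ENNReal.ofReal (poissonKer y (p.1 - p.2)) * g p.2 := by
    have h2 : Measurable fun p : ℝ × ℝ => p.1 - p.2 := by fun_prop
    exact (ENNReal.measurable_ofReal.comp ((continuous_poissonKer hy).measurable.comp h2)).mul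
      (hg.comp measurable_snd)
  rw [lintegral_lintegral_swap hm.aemeasurable]
  refine lintegral_congr fun t => ?_
  have hP : Measurable fun x => ENNReal.ofReal (poissonKer y (x - t)) :=
    ENNReal.measurable_ofReal.comp
      ((continuous_poissonKer hy).measurable.comp (measurable_id.sub_const t))
  rw [lintegral_mul_const _ hP,
    lintegral_sub_right_eq_self (fun x => ENNReal.ofReal (poissonKer y x)) t,
    lintegral_poissonKer hy, one_mul]

/-- The truncation step of the Marcinkiewicz argument: the part of `g` below the level `l` has
Poisson integral at most `l`. -/
lemma poissonInt_le_add {g : ℝ → ℝ} {l x y : ℝ} (hy : 0 < y) :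
    poissonInt (fun t => ENNReal.ofReal (g t)) x y ≤ ENNReal.ofReal l +
      poissonInt ({t | l < g t}.indicator fun t => ENNReal.ofReal (g t)) x y := by
  have hP : Measurable fun t => ENNReal.ofReal (poissonKer y (x - t)) :=
    ENNReal.measurable_ofReal.comp
      ((continuous_poissonKer hy).measurable.comp (measurable_const.sub measurable_id))
  have h1 : ∫⁻ t, ENNReal.ofReal (poissonKer y (x - t)) * ENNReal.ofReal l = ENNReal.ofReal l := by
    rw [lintegral_mul_const _ hP, lintegral_sub_left_eq_self
      (fun x => ENNReal.ofReal (poissonKer y x)) x, lintegral_poissonKer hy, one_mul]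
  rw [← h1]
  unfold poissonInt
  rw [← lintegral_add_left (hP.mul_const _)]
  refine lintegral_mono fun t => ?_
  rw [← mul_add]
  gcongr
  by_cases ht : l < g t
  · rw [indicator_of_mem (by exact ht)]
    exact le_add_self
  · exact (ENNReal.ofReal_le_ofReal (not_lt.1 ht)).trans le_self_add

lemma measurableSet_lt_poissonInt {g : ℝ → ℝ≥0∞} (hg : Measurable g) (L : ℝ≥0∞) :
    MeasurableSet {z : ℂ | L < poissonInt g z.re z.im} :=
  measurableSet_lt measurable_const
    ((measurable_poissonInt hg).comp (Complex.measurable_re.prodMk Complex.measurable_im))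

/-- The Poisson integral maps `L¹(ℝ)` to weak `L^(2 + α)` of the weighted half-plane: the set where
it exceeds `L` lies in the strip `0 < y < Y`, and Chebyshev's inequality on each horizontal line of
that strip gives the bound. -/
lemma weightedVolume_lt_poissonInt_le {α L Y : ℝ} (hα : -1 < α) (hL : 0 < L) (hY : 0 < Y)
    {g : ℝ → ℝ≥0∞} (hg : Measurable g) (hgY : ∫⁻ t, g t ≤ ENNReal.ofReal (Y * L)) :
    weightedVolume α {z | ENNReal.ofReal L < poissonInt g z.re z.im} ≤
      ENNReal.ofReal (Y ^ (α + 1) / ((α + 1) * L)) * ∫⁻ t, g t := by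
  set S := {z : ℂ | ENNReal.ofReal L < poissonInt g z.re z.im}
  have hS : MeasurableSet S := measurableSet_lt_poissonInt hg _
  have hLtop : ENNReal.ofReal L ≠ 0 := by simpa using hL
  have hmem : ∀ x y : ℝ, ((x : ℂ) + y * Complex.I ∈ S) ↔ ENNReal.ofReal L < poissonInt g x y := by
    intro x y
    simp [S]
  have hline : ∀ y : ℝ, 0 < y → ∫⁻ x : ℝ, S.indicator (fun _ => 1) (x + y * Complex.I) ≤
      (Iio Y).indicator (fun _ => (ENNReal.ofReal L)⁻¹ * ∫⁻ t, g t) y := by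
    intro y hy
    by_cases hyY : y < Y
    · rw [indicator_of_mem (mem_Iio.2 hyY), ← lintegral_poissonInt hg hy,
        ← lintegral_const_mul' _ _ (ENNReal.inv_ne_top.2 hLtop)]
      refine lintegral_mono fun x => ?_
      by_cases hx : (x : ℂ) + y * Complex.I ∈ S
      · rw [indicator_of_mem hx]
        rw [← ENNReal.inv_mul_cancel hLtop ENNReal.ofReal_ne_top]
        gcongr
        exact ((hmem x y).1 hx).le
      · rw [indicator_of_notMem hx]
        exact zero_le
    · refine (lintegral_eq_zero_of_ae_eq_zero (.of_forall fun x => ?_)).trans_le zero_le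
      refine indicator_of_notMem (fun hx => ?_) _
      refine absurd ((hmem x y).1 hx) (not_lt.2 ?_)
      refine (poissonInt_le hy).trans ((mul_le_mul_right hgY _).trans ?_)
      rw [← ENNReal.ofReal_mul (by positivity)]
      refine ENNReal.ofReal_le_ofReal ?_
      rw [inv_mul_le_iff₀ (by positivity)]
      have h1 : Y ≤ Real.pi * y := by nlinarith [Real.pi_gt_three, not_lt.1 hyY]
      gcongr
  calc weightedVolume α S = ∫⁻ z, S.indicator (fun _ => 1) z ∂(weightedVolume α) := by
        rw [lintegral_indicator_const hS, one_mul]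
    _ = ∫⁻ y in Ioi (0 : ℝ), ENNReal.ofReal (y ^ α) *
          ∫⁻ x : ℝ, S.indicator (fun _ => 1) (x + y * Complex.I) :=
        lintegral_weightedVolume α (measurable_const.indicator hS)
    _ ≤ ∫⁻ y in Ioi (0 : ℝ), (Iio Y).indicator
          (fun y => ENNReal.ofReal (y ^ α) * ((ENNReal.ofReal L)⁻¹ * ∫⁻ t, g t)) y := by
        refine setLIntegral_mono' measurableSet_Ioi fun y hy => ?_
        refine (mul_le_mul_right (hline y hy) _).trans (le_of_eq ?_)
        by_cases hyY : y ∈ Iio Y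
        · rw [indicator_of_mem hyY, indicator_of_mem hyY]
        · rw [indicator_of_notMem hyY, indicator_of_notMem hyY, mul_zero]
    _ = (∫⁻ y in Ioo 0 Y, ENNReal.ofReal (y ^ α)) * ((ENNReal.ofReal L)⁻¹ * ∫⁻ t, g t) := by
        rw [lintegral_indicator measurableSet_Iio, Measure.restrict_restrict measurableSet_Iio,
          inter_comm, Ioi_inter_Iio, lintegral_mul_const]
        exact ENNReal.measurable_ofReal.comp (measurable_id.pow_const α)
    _ = _ := by
        rw [lintegral_rpow_Ioo hα hY, ← mul_assoc, ← ENNReal.ofReal_inv_of_pos hL,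
          ← ENNReal.ofReal_mul (div_nonneg (Real.rpow_nonneg hY.le _) (by linarith)),
          ← div_eq_mul_inv, div_div]

/-! ### The Marcinkiewicz argument -/

/-- A doubling growth function is controlled by the integral of `Φ l / l`, which takes the place of
the derivative of `Φ` in the layer cake formula. -/
lemma ofReal_le_lintegral_div {Φ : ℝ → ℝ} (hΦ : IsGrowthFunction Φ) {D : ℝ} (hD : 0 < D)
    (hdouble : ∀ s, 0 < s → Φ s ≤ D * Φ (s / 2)) {s : ℝ} (hs : 0 ≤ s) :
    ENNReal.ofReal (Φ s) ≤
      ENNReal.ofReal (2 * D) * ∫⁻ l in Ioo 0 s, ENNReal.ofReal (Φ l / l) := by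
  rcases hs.eq_or_lt with rfl | hs
  · rw [hΦ.map_zero, ENNReal.ofReal_zero]; exact zero_le
  have hpos := hΦ.nonneg (half_pos hs).le
  calc ENNReal.ofReal (Φ s) ≤ ENNReal.ofReal (2 * D) *
        ∫⁻ _ in Ioo (s / 2) s, ENNReal.ofReal (Φ (s / 2) / s) := by
        rw [setLIntegral_const, Real.volume_Ioo, sub_half, ← ENNReal.ofReal_mul (by positivity),
          ← ENNReal.ofReal_mul (by positivity)]
        refine ENNReal.ofReal_le_ofReal ((hdouble s hs).trans (le_of_eq ?_))
        field_simp
    _ ≤ ENNReal.ofReal (2 * D) * ∫⁻ l in Ioo (s / 2) s, ENNReal.ofReal (Φ l / l) := by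
        refine mul_le_mul_right ?_ _
        refine setLIntegral_mono' measurableSet_Ioo fun l hl => ENNReal.ofReal_le_ofReal ?_
        have hl0 : 0 < l := (half_pos hs).trans hl.1
        have h1 : Φ (s / 2) ≤ Φ l := hΦ.monotoneOn (half_pos hs).le hl0.le hl.1.le
        have := hpos.trans h1
        gcongr
        exact hl.2.le
    _ ≤ _ := by
        gcongr
        exact (half_pos hs).le

/-- For `Φ(t)/t` nondecreasing and `∫ Φ(g) ≤ 1`, the part of `g` above the level `l` is integrable,
with integral at most `l / Φ l`. -/
lemma lintegral_indicator_lt_le {Φ : ℝ → ℝ} (hpos : ∀ t, 0 < t → 0 < Φ t)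
    (hstar : ∀ a t, 0 ≤ a → a ≤ 1 → 0 ≤ t → Φ (a * t) ≤ a * Φ t) {g : ℝ → ℝ}
    (hg1 : ∫⁻ t, ENNReal.ofReal (Φ (g t)) ≤ 1) {l : ℝ} (hl : 0 < l) :
    ∫⁻ t, ({t | l < g t}.indicator fun t => ENNReal.ofReal (g t)) t ≤
      ENNReal.ofReal (l / Φ l) := by
  calc ∫⁻ t, ({t | l < g t}.indicator fun t => ENNReal.ofReal (g t)) t
      ≤ ∫⁻ t, ENNReal.ofReal (l / Φ l) * ENNReal.ofReal (Φ (g t)) := by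
        refine lintegral_mono fun t => ?_
        by_cases ht : l < g t
        · rw [indicator_of_mem (by exact ht)]
          have hg0 : 0 < g t := hl.trans ht
          have hΦl := hpos l hl
          rw [← ENNReal.ofReal_mul (by positivity)]
          refine ENNReal.ofReal_le_ofReal ?_
          have h1 := hstar (l / g t) (g t) (by positivity) ((div_le_one hg0).2 ht.le) hg0.le
          rw [div_mul_cancel₀ _ hg0.ne', div_mul_eq_mul_div, le_div_iff₀ hg0] at h1
          rw [div_mul_eq_mul_div, le_div_iff₀ hΦl]
          linarith
        · rw [indicator_of_notMem (by exact ht)]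
          exact zero_le
    _ = ENNReal.ofReal (l / Φ l) * ∫⁻ t, ENNReal.ofReal (Φ (g t)) :=
        lintegral_const_mul' _ _ ENNReal.ofReal_ne_top
    _ ≤ _ := mul_le_of_le_one_right' hg1

/-- The modular form of the Marcinkiewicz interpolation between the weak type estimate above and
the trivial bound on `L^∞`, for functions dominated by a Poisson integral. -/
lemma exists_lintegral_le_of_le_poissonInt {Φ₁ Φ₂ : ℝ → ℝ} {α C D K a : ℝ} (hα : -1 < α)
    (hc₁ : Continuous Φ₁) (hc₂ : Continuous Φ₂)
    (h₁ : IsGrowthFunction Φ₁) (h₂ : IsGrowthFunction Φ₂)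
    (hpos : ∀ t, 0 < t → 0 < Φ₁ t)
    (hstar : ∀ a t, 0 ≤ a → a ≤ 1 → 0 ≤ t → Φ₁ (a * t) ≤ a * Φ₁ t)
    (hK : 0 < K) (hdouble₁ : ∀ s, 0 < s → Φ₁ s ≤ K * Φ₁ (s / 2))
    (hD : 0 < D) (hdouble₂ : ∀ s, 0 < s → Φ₂ s ≤ D * Φ₂ (s / 2))
    (ha : 2 ≤ a) (hsup : ∀ τ, 0 < τ → 2 * a * Φ₁ τ ≤ Φ₁ (a * τ))
    (hC : 0 < C) (hcmp : ∀ u, 0 < u → Φ₂ u ≤ C * Φ₁ u ^ (2 + α)) :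
    ∃ M : ℝ, 1 ≤ M ∧ ∀ g : ℝ → ℝ, Measurable g → (∀ t, 0 ≤ g t) →
      ∫⁻ t, ENNReal.ofReal (Φ₁ (g t)) ≤ 1 → ∀ F : ℂ → ℝ, (∀ z, 0 ≤ F z) →
      (∀ z : ℂ, 0 < z.im →
        ENNReal.ofReal (F z) ≤ poissonInt (fun t => ENNReal.ofReal (g t)) z.re z.im) →
      ∫⁻ z, ENNReal.ofReal (Φ₂ (F z)) ∂(weightedVolume α) ≤ ENNReal.ofReal M := by
  have hα1 : 0 < α + 1 := by linarith
  set C₂ : ℝ := 2 * C * K ^ (1 + α) / (α + 1) with hC₂def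
  have hC₂ : 0 < C₂ := by positivity
  set M₀ : ℝ := 2 * D * (C₂ * a ^ 2 * K)
  refine ⟨max M₀ 1, le_max_right _ _, fun g hg hg0 hg1 F hF0 hF => ?_⟩
  refine le_trans ?_ (ENNReal.ofReal_le_ofReal (le_max_left M₀ 1))
  set u : ℂ → ℝ≥0∞ := fun z => poissonInt (fun t => ENNReal.ofReal (g t)) z.re z.im with hu
  have hgm : Measurable fun t => ENNReal.ofReal (g t) := hg.ennreal_ofReal
  have hum : Measurable u :=
    (measurable_poissonInt hgm).comp (Complex.measurable_re.prodMk Complex.measurable_im)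
  -- the level sets of `u`, estimated by the weak type bound for the truncation at level `l / 2`
  have hlevel : ∀ l : ℝ, 0 < l →
      ENNReal.ofReal (Φ₂ l / l) * weightedVolume α {z | ENNReal.ofReal l < u z} ≤
        ENNReal.ofReal (C₂ * (Φ₁ l / l ^ 2)) *
          ∫⁻ t, ({t | l / 2 < g t}.indicator fun t => ENNReal.ofReal (g t)) t := by
    intro l hl
    have hl2 : 0 < l / 2 := half_pos hl
    have hΦl := hpos _ hl2
    have hΦl' := hpos _ hl
    have hsubset : weightedVolume α {z | ENNReal.ofReal l < u z} ≤
        weightedVolume α {z | ENNReal.ofReal (l / 2) <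
          poissonInt ({t | l / 2 < g t}.indicator fun t => ENNReal.ofReal (g t)) z.re z.im} := by
      refine measure_mono_ae ?_
      filter_upwards [ae_weightedVolume_im_pos α] with z hz hlz
      have h3 : ENNReal.ofReal l < u z := hlz
      have h4 := h3.trans_le (poissonInt_le_add (l := l / 2) hz)
      rw [← add_halves l, ENNReal.ofReal_add hl2.le hl2.le, add_halves] at h4
      exact (ENNReal.add_lt_add_iff_left ENNReal.ofReal_ne_top).1 h4
    have hweak := weightedVolume_lt_poissonInt_le hα hl2 (Y := (Φ₁ (l / 2))⁻¹) (by positivity)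
      (hgm.indicator (measurableSet_lt measurable_const hg))
      ((lintegral_indicator_lt_le hpos hstar hg1 hl2).trans_eq (by
        rw [div_eq_inv_mul (l / 2) (Φ₁ (l / 2))]))
    refine (mul_le_mul_right (hsubset.trans hweak) _).trans ?_
    rw [← mul_assoc, ← ENNReal.ofReal_mul (div_nonneg (h₂.nonneg hl.le) hl.le)]
    refine mul_le_mul_left (ENNReal.ofReal_le_ofReal ?_) _
    have hp : 0 < Φ₁ (l / 2) ^ (1 + α) := Real.rpow_pos_of_pos hΦl _
    have h5 : Φ₂ l ≤ C * (Φ₁ l * (K ^ (1 + α) * Φ₁ (l / 2) ^ (1 + α))) := by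
      refine (hcmp l hl).trans ?_
      rw [show 2 + α = 1 + (1 + α) by ring, Real.rpow_add hΦl', Real.rpow_one,
        ← Real.mul_rpow hK.le hΦl.le]
      gcongr
      · linarith
      · exact hdouble₁ l hl
    rw [Real.inv_rpow hΦl.le, add_comm α 1]
    calc Φ₂ l / l * ((Φ₁ (l / 2) ^ (1 + α))⁻¹ / ((1 + α) * (l / 2)))
        ≤ C * (Φ₁ l * (K ^ (1 + α) * Φ₁ (l / 2) ^ (1 + α))) / l *
          ((Φ₁ (l / 2) ^ (1 + α))⁻¹ / ((1 + α) * (l / 2))) := by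
          have : 0 < 1 + α := by linarith
          gcongr
      _ = C₂ * (Φ₁ l / l ^ 2) := by
          have : 1 + α ≠ 0 := by linarith
          rw [hC₂def, add_comm α 1]
          field_simp
  -- the inner integral after exchanging the order of integration
  have hdini : ∀ x : ℝ, (∫⁻ l in Ioi (0 : ℝ), ENNReal.ofReal (C₂ * (Φ₁ l / l ^ 2)) *
      ({t | l / 2 < g t}.indicator fun t => ENNReal.ofReal (g t)) x) ≤
      ENNReal.ofReal (C₂ * a ^ 2 * K) * ENNReal.ofReal (Φ₁ (g x)) := by
    intro x
    rcases (hg0 x).eq_or_lt with hx | hx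
    · refine (lintegral_eq_zero_of_ae_eq_zero (.of_forall fun l => ?_)).trans_le zero_le
      by_cases hl : l / 2 < g x
      · simp [indicator, ← hx]
      · simp [indicator, hl]
    have hx2 : 0 < 2 * g x := by positivity
    have hΦx := h₁.nonneg hx2.le
    calc ∫⁻ l in Ioi (0 : ℝ), ENNReal.ofReal (C₂ * (Φ₁ l / l ^ 2)) *
          ({t | l / 2 < g t}.indicator fun t => ENNReal.ofReal (g t)) x
        = ∫⁻ l in Ioi (0 : ℝ), (Iio (2 * g x)).indicator
            (fun l => ENNReal.ofReal (C₂ * g x) * ENNReal.ofReal (Φ₁ l / l ^ 2)) l := by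
          refine setLIntegral_congr_fun measurableSet_Ioi fun l hl => ?_
          have hiff : l / 2 < g x ↔ l < 2 * g x := by rw [div_lt_iff₀ two_pos, mul_comm]
          have hΦ := h₁.nonneg (le_of_lt (mem_Ioi.1 hl))
          simp only [indicator, mem_ofPred_eq, mem_Iio, hiff]
          split_ifs
          · rw [← ENNReal.ofReal_mul (by positivity), ← ENNReal.ofReal_mul (by positivity)]
            congr 1
            ring
          · rw [mul_zero]
      _ ≤ ∫⁻ l in Ioc 0 (2 * g x), ENNReal.ofReal (C₂ * g x) * ENNReal.ofReal (Φ₁ l / l ^ 2) := by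
          rw [lintegral_indicator measurableSet_Iio, Measure.restrict_restrict measurableSet_Iio,
            inter_comm, Ioi_inter_Iio]
          exact lintegral_mono_set Ioo_subset_Ioc_self
      _ ≤ ENNReal.ofReal (C₂ * g x) *
            ENNReal.ofReal (2 * a ^ 2 * (Φ₁ (2 * g x) / (2 * g x))) := by
          rw [lintegral_const_mul' _ _ ENNReal.ofReal_ne_top]
          gcongr
          exact lintegral_div_sq_le h₁ ha hsup hx2
      _ ≤ _ := by
          rw [← ENNReal.ofReal_mul (by positivity), ← ENNReal.ofReal_mul (by positivity)]
          refine ENNReal.ofReal_le_ofReal ?_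
          have h6 := hdouble₁ _ hx2
          rw [mul_div_cancel_left₀ _ two_ne_zero] at h6
          calc C₂ * g x * (2 * a ^ 2 * (Φ₁ (2 * g x) / (2 * g x)))
              = C₂ * a ^ 2 * Φ₁ (2 * g x) := by field_simp
            _ ≤ C₂ * a ^ 2 * (K * Φ₁ (g x)) := by gcongr
            _ = _ := by ring
  have hm₁ : Measurable fun p : ℂ × ℝ => ENNReal.ofReal (Φ₂ p.2 / p.2) *
      {z | ENNReal.ofReal p.2 < u z}.indicator (fun _ => (1 : ℝ≥0∞)) p.1 := by
    refine Measurable.mul (ENNReal.measurable_ofReal.comp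
      ((hc₂.measurable.comp measurable_snd).div measurable_snd)) ?_
    exact (measurable_const (a := (1 : ℝ≥0∞))).indicator
      (s := {p : ℂ × ℝ | ENNReal.ofReal p.2 < u p.1})
      (measurableSet_lt (ENNReal.measurable_ofReal.comp measurable_snd) (hum.comp measurable_fst))
  have hm₂ : Measurable fun p : ℝ × ℝ => ENNReal.ofReal (C₂ * (Φ₁ p.1 / p.1 ^ 2)) *
      ({t | p.1 / 2 < g t}.indicator fun t => ENNReal.ofReal (g t)) p.2 := by
    refine Measurable.mul (ENNReal.measurable_ofReal.comp
      (((hc₁.measurable.comp measurable_fst).div (measurable_fst.pow_const 2)).const_mul _)) ?_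
    exact (hgm.comp measurable_snd).indicator (s := {p : ℝ × ℝ | p.1 / 2 < g p.2})
      (measurableSet_lt (measurable_fst.div_const 2) (hg.comp measurable_snd))
  calc ∫⁻ z, ENNReal.ofReal (Φ₂ (F z)) ∂(weightedVolume α)
      ≤ ∫⁻ z, ENNReal.ofReal (2 * D) * (∫⁻ l in Ioi (0 : ℝ), ENNReal.ofReal (Φ₂ l / l) *
          {z | ENNReal.ofReal l < u z}.indicator (fun _ => 1) z) ∂(weightedVolume α) := by
        refine lintegral_mono_ae ?_
        filter_upwards [ae_weightedVolume_im_pos α] with z hz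
        refine (ofReal_le_lintegral_div h₂ hD hdouble₂ (hF0 z)).trans ?_
        refine mul_le_mul_right ?_ _
        rw [← Ioi_inter_Iio, inter_comm, ← Measure.restrict_restrict measurableSet_Iio,
          ← lintegral_indicator measurableSet_Iio]
        refine setLIntegral_mono' measurableSet_Ioi fun l hl => ?_
        by_cases hlF : l < F z
        · have hlu : ENNReal.ofReal l < u z :=
            ((ENNReal.ofReal_lt_ofReal_iff (lt_trans hl hlF)).2 hlF).trans_le (hF z hz)
          simp [indicator, hlF, hlu]
        · rw [indicator_of_notMem (by simpa using hlF)]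
          exact zero_le
    _ = ENNReal.ofReal (2 * D) * ∫⁻ l in Ioi (0 : ℝ), ENNReal.ofReal (Φ₂ l / l) *
          weightedVolume α {z | ENNReal.ofReal l < u z} := by
        rw [lintegral_const_mul' _ _ ENNReal.ofReal_ne_top,
          lintegral_lintegral_swap hm₁.aemeasurable]
        congr 1
        refine lintegral_congr fun l => ?_
        rw [lintegral_const_mul' _ _ ENNReal.ofReal_ne_top, lintegral_indicator_const
          (measurableSet_lt measurable_const hum), one_mul]
    _ ≤ ENNReal.ofReal (2 * D) * ∫⁻ l in Ioi (0 : ℝ), ∫⁻ t,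
          ENNReal.ofReal (C₂ * (Φ₁ l / l ^ 2)) *
            ({t | l / 2 < g t}.indicator fun t => ENNReal.ofReal (g t)) t := by
        gcongr ENNReal.ofReal (2 * D) * ?_
        refine setLIntegral_mono' measurableSet_Ioi fun l hl => ?_
        rw [lintegral_const_mul' _ _ ENNReal.ofReal_ne_top]
        exact hlevel l hl
    _ ≤ ENNReal.ofReal (2 * D) *
          ∫⁻ x, ENNReal.ofReal (C₂ * a ^ 2 * K) * ENNReal.ofReal (Φ₁ (g x)) := by
        rw [lintegral_lintegral_swap hm₂.aemeasurable]
        gcongr with x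
        exact hdini x
    _ ≤ ENNReal.ofReal (2 * D) * ENNReal.ofReal (C₂ * a ^ 2 * K) := by
        rw [lintegral_const_mul' _ _ ENNReal.ofReal_ne_top]
        gcongr
        exact mul_le_of_le_one_right' hg1
    _ = ENNReal.ofReal M₀ := by rw [← ENNReal.ofReal_mul (by positivity)]

/-! ### Luxemburg norms and modulars -/

section Lux

variable {X : Type*} [MeasurableSpace X] {Φ : ℝ → ℝ} {μ : Measure X} {f : X → ℂ} {l : ℝ}

lemma luxNorm_le (hl : 0 < l) (h : modular Φ μ f l ≤ 1) : luxNorm Φ μ f ≤ ENNReal.ofReal l :=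
  sInf_le (mem_image_of_mem _ ⟨hl, h⟩)

lemma modular_le_one_of_luxNorm_lt (hΦ : IsGrowthFunction Φ)
    (h : luxNorm Φ μ f < ENNReal.ofReal l) : modular Φ μ f l ≤ 1 := by
  obtain ⟨_, ⟨m, ⟨hm, hmod⟩, rfl⟩, hml⟩ := sInf_lt_iff.1 h
  have hml' : m < l := (ENNReal.ofReal_lt_ofReal_iff_of_nonneg hm.le).1 hml
  have hl : 0 < l := hm.trans hml'
  refine le_trans (lintegral_mono fun x => ENNReal.ofReal_le_ofReal ?_) hmod
  refine hΦ.monotoneOn (mem_Ici.2 (by positivity)) (mem_Ici.2 (by positivity)) ?_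
  gcongr

/-- By convexity, a bound `M` on the modular at level `l` becomes the bound `1` at level `M * l`. -/
lemma IsC1ConvexGrowth.modular_mul_le_one (hΦ : IsC1ConvexGrowth Φ) {M : ℝ} (hM : 1 ≤ M)
    (hl : 0 < l) (h : modular Φ μ f l ≤ ENNReal.ofReal M) : modular Φ μ f (M * l) ≤ 1 := by
  have hM0 : 0 < M := by linarith
  calc modular Φ μ f (M * l) ≤ ∫⁻ x, ENNReal.ofReal M⁻¹ * ENNReal.ofReal (Φ (‖f x‖ / l)) ∂μ := by
        refine lintegral_mono fun x => ?_
        rw [← ENNReal.ofReal_mul (by positivity)]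
        refine ENNReal.ofReal_le_ofReal ?_
        rw [show ‖f x‖ / (M * l) = M⁻¹ * (‖f x‖ / l) by field_simp]
        exact hΦ.map_mul_le (by positivity) (inv_le_one_of_one_le₀ hM) (by positivity)
    _ = ENNReal.ofReal M⁻¹ * modular Φ μ f l := lintegral_const_mul' _ _ ENNReal.ofReal_ne_top
    _ ≤ ENNReal.ofReal M⁻¹ * ENNReal.ofReal M := by gcongr
    _ = 1 := by
        rw [← ENNReal.ofReal_mul (by positivity), inv_mul_cancel₀ hM0.ne', ENNReal.ofReal_one]

end Lux

/-! ### Boundedness on smaller half-planes -/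

lemma weightedVolume_zero : weightedVolume 0 = volume.restrict upperHalf := by
  simp [weightedVolume]

lemma lintegral_strip_le {H : ℂ → ℝ≥0∞} (hH : Measurable H)
    (h : ∀ y : ℝ, 0 < y → ∫⁻ x : ℝ, H (x + y * Complex.I) ≤ 1) {a b : ℝ} (ha : 0 ≤ a) :
    ∫⁻ z in {z : ℂ | a < z.im ∧ z.im < b}, H z ≤ ENNReal.ofReal (b - a) := by
  set S := {z : ℂ | a < z.im ∧ z.im < b}
  have hS : MeasurableSet S :=
    (measurableSet_lt measurable_const Complex.measurable_im).inter
      (measurableSet_lt Complex.measurable_im measurable_const)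
  have hSU : S ⊆ upperHalf := fun z hz => lt_of_le_of_lt ha hz.1
  calc ∫⁻ z in S, H z = ∫⁻ z, S.indicator H z ∂(weightedVolume 0) := by
        rw [weightedVolume_zero, lintegral_indicator hS, Measure.restrict_restrict hS,
          inter_eq_left.2 hSU]
    _ = ∫⁻ y in Ioi (0 : ℝ), ENNReal.ofReal (y ^ (0 : ℝ)) *
          ∫⁻ x : ℝ, S.indicator H (x + y * Complex.I) :=
        lintegral_weightedVolume 0 (hH.indicator hS)
    _ ≤ ∫⁻ y in Ioi (0 : ℝ), (Ioo a b).indicator (fun _ => 1) y := by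
        refine setLIntegral_mono' measurableSet_Ioi fun y hy => ?_
        rw [Real.rpow_zero, ENNReal.ofReal_one, one_mul]
        by_cases hyab : y ∈ Ioo a b
        · rw [indicator_of_mem hyab]
          refine (lintegral_mono fun x => ?_).trans (h y hy)
          exact indicator_le_self _ _ _
        · rw [indicator_of_notMem hyab]
          refine (lintegral_eq_zero_of_ae_eq_zero (.of_forall fun x => ?_)).le
          refine indicator_of_notMem (fun hx => hyab ?_) _
          simpa [S] using hx
    _ ≤ ∫⁻ y, (Ioo a b).indicator (fun _ => 1) y := setLIntegral_le_lintegral _ _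
    _ = ENNReal.ofReal (b - a) := by
        rw [lintegral_indicator_const measurableSet_Ioo, one_mul, Real.volume_Ioo]

/-- A function in the unit ball of the Hardy-Orlicz space is bounded on `{Im z ≥ ε}`: the area mean
value inequality applies, and a convex growth function dominates the identity up to constants. -/
lemma exists_norm_le_of_lintegral_le {Φ : ℝ → ℝ} (hc : Continuous Φ)
    (hpos : ∀ t, 0 < t → 0 < Φ t)
    (hstar : ∀ a t, 0 ≤ a → a ≤ 1 → 0 ≤ t → Φ (a * t) ≤ a * Φ t)
    {f : ℂ → ℂ} (hfm : Measurable f) (hf : DifferentiableOn ℂ f upperHalf)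
    (h : ∀ y : ℝ, 0 < y → ∫⁻ x : ℝ, ENNReal.ofReal (Φ ‖f (x + y * Complex.I)‖) ≤ 1)
    {ε : ℝ} (hε : 0 < ε) : ∃ B : ℝ, ∀ z : ℂ, ε ≤ z.im → ‖f z‖ ≤ B := by
  have hΦ1 := hpos 1 one_pos
  set r := ε / 2 with hr
  have hr0 : 0 < r := half_pos hε
  set M : ℝ≥0∞ := volume (Metric.ball (0 : ℂ) r) +
    ENNReal.ofReal (Φ 1)⁻¹ * ENNReal.ofReal (2 * r)
  have hMtop : M ≠ ∞ := ENNReal.add_ne_top.2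
    ⟨measure_ball_lt_top.ne, ENNReal.mul_ne_top ENNReal.ofReal_ne_top ENNReal.ofReal_ne_top⟩
  have hlin : ∀ s : ℝ, 0 ≤ s → ENNReal.ofReal s ≤
      1 + ENNReal.ofReal (Φ 1)⁻¹ * ENNReal.ofReal (Φ s) := by
    intro s hs
    rcases le_total s 1 with hs1 | hs1
    · exact (ENNReal.ofReal_le_one.2 hs1).trans le_self_add
    · refine le_trans ?_ le_add_self
      have hs0 : 0 < s := by linarith
      rw [← ENNReal.ofReal_mul (by positivity)]
      refine ENNReal.ofReal_le_ofReal ?_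
      have := hstar s⁻¹ s (by positivity) (inv_le_one_of_one_le₀ hs1) hs
      rw [inv_mul_cancel₀ hs0.ne', le_inv_mul_iff₀ hs0] at this
      rw [le_inv_mul_iff₀ hΦ1]
      linarith
  refine ⟨M.toReal / r ^ 2, fun z hz => ?_⟩
  have hHm : Measurable fun w => ENNReal.ofReal (Φ ‖f w‖) :=
    (hc.measurable.comp hfm.norm).ennreal_ofReal
  have him : ∀ w : ℂ, |w.im - z.im| ≤ dist w z := fun w => by
    rw [dist_eq_norm, ← Complex.sub_im]
    exact Complex.abs_im_le_norm _
  have hsub : Metric.closedBall z r ⊆ upperHalf := fun w hw => by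
    have := (him w).trans (Metric.mem_closedBall.1 hw)
    have := (abs_le.1 this).1
    have : 0 < w.im := by linarith
    exact this
  have hball : Metric.ball z r ⊆ {w : ℂ | z.im - r < w.im ∧ w.im < z.im + r} := fun w hw => by
    have := abs_lt.1 ((him w).trans_lt (Metric.mem_ball.1 hw))
    constructor <;> linarith
  have key : ENNReal.ofReal (r ^ 2) * ‖f z‖ₑ ≤ M := by
    calc ENNReal.ofReal (r ^ 2) * ‖f z‖ₑ ≤ ∫⁻ w in Metric.ball z r, ‖f w‖ₑ :=
          enorm_le_lintegral_ball hr0 (hf.mono hsub)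
      _ ≤ ∫⁻ w in Metric.ball z r, (1 + ENNReal.ofReal (Φ 1)⁻¹ * ENNReal.ofReal (Φ ‖f w‖)) := by
          refine lintegral_mono fun w => ?_
          rw [← ofReal_norm]
          exact hlin _ (norm_nonneg _)
      _ = volume (Metric.ball (0 : ℂ) r) + ENNReal.ofReal (Φ 1)⁻¹ *
            ∫⁻ w in Metric.ball z r, ENNReal.ofReal (Φ ‖f w‖) := by
          rw [lintegral_add_left measurable_const, setLIntegral_const, one_mul,
            lintegral_const_mul' _ _ ENNReal.ofReal_ne_top, Measure.addHaar_ball_center]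
      _ ≤ M := by
          refine add_le_add le_rfl (mul_le_mul_right ?_ _)
          refine (lintegral_mono_set hball).trans
            ((lintegral_strip_le hHm h (by linarith)).trans_eq ?_)
          congr 1
          ring
  rw [le_div_iff₀ (by positivity), mul_comm]
  have := ENNReal.toReal_mono hMtop key
  rwa [ENNReal.toReal_mul, ENNReal.toReal_ofReal (by positivity), toReal_enorm] at this

/-! ### Sufficiency -/

/-- The embedding in modular form. For `ε > 0` the translate `f(· + i ε)` is bounded, hence
dominated by the Poisson integral of its boundary values; the bound obtained does not depend on `ε`
and passes to the limit by Fatou's lemma. -/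
lemma exists_modular_le {Φ₁ Φ₂ : ℝ → ℝ} {α C D K a : ℝ} (hα : -1 < α)
    (h₁ : IsGrowthFunction Φ₁) (h₂ : IsGrowthFunction Φ₂)
    (hpos : ∀ t, 0 < t → 0 < Φ₁ t)
    (hstar : ∀ a t, 0 ≤ a → a ≤ 1 → 0 ≤ t → Φ₁ (a * t) ≤ a * Φ₁ t)
    (hK : 0 < K) (hdouble₁ : ∀ s, 0 < s → Φ₁ s ≤ K * Φ₁ (s / 2))
    (hD : 0 < D) (hdouble₂ : ∀ s, 0 < s → Φ₂ s ≤ D * Φ₂ (s / 2))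
    (ha : 2 ≤ a) (hsup : ∀ τ, 0 < τ → 2 * a * Φ₁ τ ≤ Φ₁ (a * τ))
    (hC : 0 < C) (hcmp : ∀ u, 0 < u → Φ₂ u ≤ C * Φ₁ u ^ (2 + α)) :
    ∃ M : ℝ, 1 ≤ M ∧ ∀ f : ℂ → ℂ, DifferentiableOn ℂ f upperHalf → ∀ l : ℝ, 0 < l →
      (∀ y : ℝ, 0 < y → modular Φ₁ volume (fun x : ℝ => f (x + y * Complex.I)) l ≤ 1) →
      modular Φ₂ (weightedVolume α) f l ≤ ENNReal.ofReal M := by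
  -- the values at negative arguments are replaced, to have continuous functions on the whole line
  have hext : ∀ {Φ : ℝ → ℝ}, IsGrowthFunction Φ → Continuous fun t => Φ (max t 0) := fun h =>
    h.continuousOn.comp_continuous (by fun_prop) fun t => le_max_right t 0
  have hgrowth : ∀ {Φ : ℝ → ℝ}, IsGrowthFunction Φ →
      IsGrowthFunction fun t => Φ (max t 0) := fun {Φ} h =>
    { continuousOn := (hext h).continuousOn
      monotoneOn := h.monotoneOn.congr fun t ht => by
        rw [max_eq_left (mem_Ici.1 ht)]
      image_eq := (image_congr fun t ht => by
        rw [max_eq_left (mem_Ici.1 ht)]).trans h.image_eq }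
  obtain ⟨M, hM1, hM⟩ := exists_lintegral_le_of_le_poissonInt (Φ₁ := fun t => Φ₁ (max t 0))
    (Φ₂ := fun t => Φ₂ (max t 0)) (C := C) (D := D) (K := K) (a := a) hα (hext h₁) (hext h₂)
    (hgrowth h₁) (hgrowth h₂)
    (fun t ht => by rw [max_eq_left ht.le]; exact hpos t ht)
    (fun b t hb hb1 ht => by
        rw [max_eq_left ht, max_eq_left (mul_nonneg hb ht)]
        exact hstar b t hb hb1 ht)
    hK (fun s hs => by rw [max_eq_left hs.le, max_eq_left (half_pos hs).le]; exact hdouble₁ s hs)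
    hD (fun s hs => by rw [max_eq_left hs.le, max_eq_left (half_pos hs).le]; exact hdouble₂ s hs)
    ha (fun s hs => by
      rw [max_eq_left hs.le, max_eq_left (by positivity : 0 ≤ a * s)]
      exact hsup s hs)
    hC (fun s hs => by rw [max_eq_left hs.le]; exact hcmp s hs)
  refine ⟨M, hM1, fun f hf l hl hmod => ?_⟩
  have hUo : IsOpen upperHalf := isOpen_lt continuous_const Complex.continuous_im
  set h : ℂ → ℂ := upperHalf.indicator fun z => f z / l with hh
  have hhv : ∀ z : ℂ, 0 < z.im → ‖h z‖ = ‖f z‖ / l := fun z hz => by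
    rw [hh, indicator_of_mem (by exact hz), norm_div, Complex.norm_real, Real.norm_of_nonneg hl.le]
  have hhd : DifferentiableOn ℂ h upperHalf :=
    (hf.div_const (l : ℂ)).congr fun z hz => indicator_of_mem hz _
  have hhm : Measurable h := by
    classical
    rw [hh, ← piecewise_eq_indicator]
    exact (hf.div_const (l : ℂ)).continuousOn.measurable_piecewise continuousOn_const
      measurableSet_upperHalf
  have hline : ∀ y : ℝ, 0 < y →
      ∫⁻ x : ℝ, ENNReal.ofReal (Φ₁ (max ‖h (x + y * Complex.I)‖ 0)) ≤ 1 := by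
    intro y hy
    refine le_trans (lintegral_mono fun x => ?_) (hmod y hy)
    rw [max_eq_left (norm_nonneg _), hhv _ (by simpa using hy)]
  have hshift : ∀ ε : ℝ, 0 < ε →
      ∫⁻ z, ENNReal.ofReal (Φ₂ (max ‖h (z + ε * Complex.I)‖ 0)) ∂(weightedVolume α) ≤
        ENNReal.ofReal M := by
    intro ε hε
    obtain ⟨B, hB⟩ := exists_norm_le_of_lintegral_le (hext h₁)
      (fun t ht => by rw [max_eq_left ht.le]; exact hpos t ht)
      (fun b t hb hb1 ht => by
        rw [max_eq_left ht, max_eq_left (mul_nonneg hb ht)]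
        exact hstar b t hb hb1 ht)
      hhm hhd hline hε
    refine hM (fun t => ‖h (t + ε * Complex.I)‖) ?_ (fun t => norm_nonneg _) (hline ε hε)
      (fun z => ‖h (z + ε * Complex.I)‖) (fun z => norm_nonneg _) fun z hz => ?_
    · exact (hhm.comp (by fun_prop : Measurable fun t : ℝ => (t : ℂ) + ε * Complex.I)).norm
    · have hVo : IsOpen {w : ℂ | -ε < w.im} := isOpen_lt continuous_const Complex.continuous_im
      have hd : DifferentiableOn ℂ (fun w => h (w + ε * Complex.I)) {w : ℂ | -ε < w.im} := by
        refine hhd.comp (by fun_prop) fun w hw => ?_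
        have hw' : -ε < w.im := hw
        have : 0 < (w + ε * Complex.I).im := by simp; linarith
        exact this
      have := enorm_le_poissonInt (F := fun w => h (w + ε * Complex.I)) (B := B) hVo
        (fun w hw => lt_of_lt_of_le (neg_lt_zero.2 hε) hw) hd
        (fun w hw => hB _ (by simpa using hw)) (x := z.re) hz
      rw [Complex.re_add_im, ← ofReal_norm] at this
      simp_rw [← ofReal_norm] at this
      exact this
  set e : ℕ → ℝ := fun n => 1 / ((n : ℝ) + 1)
  have he : ∀ n, 0 < e n := fun n => Nat.one_div_pos_of_nat
  have he0 : Filter.Tendsto e Filter.atTop (nhds 0) := tendsto_one_div_add_atTop_nhds_zero_nat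
  calc modular Φ₂ (weightedVolume α) f l
      ≤ ∫⁻ z, Filter.liminf (fun n => ENNReal.ofReal (Φ₂ (max ‖h (z + e n * Complex.I)‖ 0)))
          Filter.atTop ∂(weightedVolume α) := by
        refine lintegral_mono_ae ?_
        filter_upwards [ae_weightedVolume_im_pos α] with z hz
        have hcz : ContinuousAt h z :=
          (hhd.differentiableAt (hUo.mem_nhds hz)).continuousAt
        have hz' : Filter.Tendsto (fun n => z + e n * Complex.I) Filter.atTop (nhds z) := by
          have h1 : Continuous fun s : ℝ => z + s * Complex.I := by fun_prop
          have := (h1.tendsto 0).comp he0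
          simpa [Function.comp_def] using this
        have hlim := ((ENNReal.continuous_ofReal.comp (hext h₂)).tendsto _).comp
          (hcz.tendsto.comp hz').norm
        have h2 := hlim.liminf_eq
        simp only [Function.comp_def] at h2
        rw [h2, max_eq_left (norm_nonneg _), hhv z hz]
    _ ≤ Filter.liminf (fun n => ∫⁻ z, ENNReal.ofReal (Φ₂ (max ‖h (z + e n * Complex.I)‖ 0))
          ∂(weightedVolume α)) Filter.atTop := by
        refine lintegral_liminf_le fun n => ENNReal.measurable_ofReal.comp
          ((hext h₂).measurable.comp (hhm.comp ?_).norm)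
        fun_prop
    _ ≤ Filter.liminf (fun _ : ℕ => ENNReal.ofReal M) Filter.atTop :=
        Filter.liminf_le_liminf (.of_forall fun n => hshift _ (he n))
    _ = ENNReal.ofReal M := Filter.liminf_const _

lemma embedsContinuously_of_modular_le {Φ₁ Φ₂ : ℝ → ℝ} {α M q : ℝ}
    (h₁ : IsGrowthFunction Φ₁) (h₂ : IsC1ConvexGrowth Φ₂) (hq : IsUpperType Φ₂ q) (hM1 : 1 ≤ M)
    (hM : ∀ f : ℂ → ℂ, DifferentiableOn ℂ f upperHalf → ∀ l : ℝ, 0 < l →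
      (∀ y : ℝ, 0 < y → modular Φ₁ volume (fun x : ℝ => f (x + y * Complex.I)) l ≤ 1) →
      modular Φ₂ (weightedVolume α) f l ≤ ENNReal.ofReal M) :
    EmbedsContinuously Φ₁ Φ₂ α := by
  have hmod : ∀ f ∈ hardyOrlicz Φ₁, ∀ l : ℝ, 0 < l → hardyNorm Φ₁ f < ENNReal.ofReal l →
      modular Φ₂ (weightedVolume α) f l ≤ ENNReal.ofReal M := fun f hf l hl hlt =>
    hM f hf.1 l hl fun y hy => modular_le_one_of_luxNorm_lt h₁ <| lt_of_le_of_lt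
      (le_iSup₂ (f := fun (y : ℝ) (_ : y ∈ Ioi (0 : ℝ)) =>
        luxNorm Φ₁ volume (fun x : ℝ => f (x + y * Complex.I))) y hy) hlt
  have hM0 : 0 < M := by linarith
  refine ⟨fun f hf => ⟨hf.1, ?_⟩, M, hM0, fun f hf => ?_⟩
  · obtain ⟨C, hC, hup⟩ := hq
    set l : ℝ := (hardyNorm Φ₁ f).toReal + 1
    have hl1 : 1 ≤ l := by simp [l]
    have hl : 0 < l := by linarith
    have hlt : hardyNorm Φ₁ f < ENNReal.ofReal l := by
      rw [ENNReal.lt_ofReal_iff_toReal_lt hf.2.ne]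
      exact lt_add_one _
    calc ∫⁻ z, ENNReal.ofReal (Φ₂ ‖f z‖) ∂(weightedVolume α)
        ≤ ∫⁻ z, ENNReal.ofReal (C * l ^ q) * ENNReal.ofReal (Φ₂ (‖f z‖ / l))
            ∂(weightedVolume α) := by
          refine lintegral_mono fun z => ?_
          rw [← ENNReal.ofReal_mul (by positivity)]
          refine ENNReal.ofReal_le_ofReal ?_
          rcases (norm_nonneg (f z)).eq_or_lt with h0 | h0
          · rw [← h0, zero_div, h₂.growth.map_zero, mul_zero]
          · have := hup (‖f z‖ / l) l (by positivity) hl1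
            rwa [div_mul_cancel₀ _ hl.ne'] at this
      _ = ENNReal.ofReal (C * l ^ q) * modular Φ₂ (weightedVolume α) f l :=
          lintegral_const_mul' _ _ ENNReal.ofReal_ne_top
      _ < ∞ := ENNReal.mul_lt_top ENNReal.ofReal_lt_top
          ((hmod f hf l hl hlt).trans_lt ENNReal.ofReal_lt_top)
  · refine ENNReal.le_of_forall_pos_le_add fun δ hδ _ => ?_
    set n : ℝ := (hardyNorm Φ₁ f).toReal
    have hδ' : (0 : ℝ) < δ := hδ
    have hn : 0 ≤ n := ENNReal.toReal_nonneg
    have hl : 0 < n + δ / M := by positivity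
    have hlt : hardyNorm Φ₁ f < ENNReal.ofReal (n + δ / M) := by
      rw [ENNReal.lt_ofReal_iff_toReal_lt hf.2.ne]
      have : 0 < δ / M := by positivity
      exact lt_add_of_pos_right _ this
    refine (luxNorm_le (mul_pos hM0 hl)
      (h₂.modular_mul_le_one hM1 hl (hmod f hf _ hl hlt))).trans (le_of_eq ?_)
    rw [mul_add, mul_div_cancel₀ _ hM0.ne', ENNReal.ofReal_add (by positivity) hδ'.le,
      ENNReal.ofReal_mul hM0.le, ENNReal.ofReal_toReal hf.2.ne, ENNReal.ofReal_coe_nnreal]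

/-! ### Necessity -/

/-- The volume of the Carleson box over an interval of length `2 y`. -/
lemma weightedVolume_box {α y : ℝ} (hα : -1 < α) (hy : 0 < y) :
    weightedVolume α {z : ℂ | z.re ∈ Ioo (-y) y ∧ z.im ∈ Ioo 0 y} =
      ENNReal.ofReal (2 * y * (y ^ (α + 1) / (α + 1))) := by
  set S := {z : ℂ | z.re ∈ Ioo (-y) y ∧ z.im ∈ Ioo 0 y}
  have hS : MeasurableSet S :=
    (Complex.measurable_re measurableSet_Ioo).inter (Complex.measurable_im measurableSet_Ioo)
  have hline : ∀ t : ℝ, ∫⁻ x : ℝ, S.indicator (fun _ => (1 : ℝ≥0∞)) (x + t * Complex.I) =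
      (Ioo 0 y).indicator (fun _ => ENNReal.ofReal (2 * y)) t := by
    intro t
    have hmem : ∀ x : ℝ, ((x : ℂ) + t * Complex.I ∈ S) ↔ x ∈ Ioo (-y) y ∧ t ∈ Ioo 0 y := by
      intro x; simp [S]
    by_cases ht : t ∈ Ioo 0 y
    · rw [indicator_of_mem ht, show 2 * y = y - -y by ring, ← Real.volume_Ioo,
        ← one_mul (volume (Ioo (-y) y)), ← lintegral_indicator_const measurableSet_Ioo]
      refine lintegral_congr fun x => ?_
      by_cases hx : x ∈ Ioo (-y) y
      · rw [indicator_of_mem hx, indicator_of_mem ((hmem x).2 ⟨hx, ht⟩)]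
      · rw [indicator_of_notMem hx, indicator_of_notMem fun h => hx ((hmem x).1 h).1]
    · rw [indicator_of_notMem ht]
      exact lintegral_eq_zero_of_ae_eq_zero
        (.of_forall fun x => indicator_of_notMem (fun h => ht ((hmem x).1 h).2) _)
  rw [← one_mul (weightedVolume α S), ← lintegral_indicator_const hS,
    lintegral_weightedVolume α (measurable_const.indicator hS)]
  simp_rw [hline]
  have hmul : ∀ t : ℝ, ENNReal.ofReal (t ^ α) *
      (Ioo 0 y).indicator (fun _ => ENNReal.ofReal (2 * y)) t =
      (Ioo 0 y).indicator (fun t => ENNReal.ofReal (t ^ α) * ENNReal.ofReal (2 * y)) t := by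
    intro t
    by_cases ht : t ∈ Ioo 0 y
    · rw [indicator_of_mem ht, indicator_of_mem ht]
    · rw [indicator_of_notMem ht, indicator_of_notMem ht, mul_zero]
  simp_rw [hmul]
  rw [lintegral_indicator measurableSet_Ioo, Measure.restrict_restrict measurableSet_Ioo,
    inter_eq_left.2 Ioo_subset_Ioi_self, lintegral_mul_const' _ _ ENNReal.ofReal_ne_top,
    lintegral_rpow_Ioo hα hy, mul_comm, ← ENNReal.ofReal_mul (by positivity)]

/-- The test functions `u y² / (z + i y)²`, with `y = 1 / Φ₁ u`, are bounded in the Hardy-Orlicz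
space and comparable to `u` on the Carleson box of side `y`. -/
lemma exists_le_rpow_of_embedsContinuously {Φ₁ Φ₂ : ℝ → ℝ} {α q : ℝ} (hα : -1 < α)
    (h₁ : IsC1ConvexGrowth Φ₁) (hpos : ∀ t, 0 < t → 0 < Φ₁ t)
    (h₂ : IsGrowthFunction Φ₂) (hq : IsUpperType Φ₂ q) (hemb : EmbedsContinuously Φ₁ Φ₂ α) :
    ∃ C : ℝ, 0 < C ∧ ∀ u : ℝ, 0 < u → Φ₂ u ≤ C * Φ₁ u ^ (2 + α) := by
  obtain ⟨-, C', hC', hnorm⟩ := hemb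
  obtain ⟨C₀, hC₀, hup⟩ := hq
  have hα1 : 0 < α + 1 := by linarith
  set L : ℝ := max (5 * C') 1
  have hL1 : 1 ≤ L := le_max_right _ _
  have hL : 0 < L := by linarith
  have hL4 : C' * 4 < L := lt_of_lt_of_le (by linarith) (le_max_left (5 * C') 1)
  refine ⟨C₀ * (5 * L) ^ q * ((α + 1) / 2), by positivity, fun u hu => ?_⟩
  have hΦu := hpos u hu
  set y : ℝ := (Φ₁ u)⁻¹ with hy_def
  have hy : 0 < y := by positivity
  set f : ℂ → ℂ := fun z => u * y ^ 2 / (z + y * Complex.I) ^ 2 with hf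
  have hfd : DifferentiableOn ℂ f upperHalf := by
    refine DifferentiableOn.div (by fun_prop) (by fun_prop) fun z hz h0 => ?_
    have h1 := congrArg Complex.im (pow_eq_zero_iff two_ne_zero |>.1 h0)
    have hz' : 0 < z.im := hz
    simp at h1
    linarith
  have hfn : ∀ z : ℂ, ‖f z‖ = u * (y ^ 2 / (z.re ^ 2 + (z.im + y) ^ 2)) := by
    intro z
    rw [hf]
    simp only
    rw [norm_div, norm_pow, Complex.sq_norm, Complex.normSq_apply, norm_mul, norm_pow,
      Complex.norm_real, Complex.norm_real, Real.norm_of_nonneg hu.le, Real.norm_of_nonneg hy.le]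
    simp
    ring
  have hline : ∀ η : ℝ, 0 < η →
      modular Φ₁ volume (fun x : ℝ => f (x + η * Complex.I)) 4 ≤ 1 := by
    intro η hη
    calc modular Φ₁ volume (fun x : ℝ => f (x + η * Complex.I)) 4
        ≤ ∫⁻ x, ENNReal.ofReal (Real.pi / 4) * ENNReal.ofReal (poissonKer y x) := by
          refine lintegral_mono fun x => ?_
          rw [← ENNReal.ofReal_mul (by positivity)]
          refine ENNReal.ofReal_le_ofReal ?_
          have hθ1 : y ^ 2 / (x ^ 2 + y ^ 2) ≤ 1 := by
            rw [div_le_one (by positivity)]; nlinarith [sq_nonneg x]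
          have hle : ‖f (x + η * Complex.I)‖ / 4 ≤ y ^ 2 / (x ^ 2 + y ^ 2) / 4 * u := by
            rw [hfn]
            have : y ^ 2 / (x ^ 2 + (η + y) ^ 2) ≤ y ^ 2 / (x ^ 2 + y ^ 2) := by
              gcongr
              linarith
            simp only [Complex.add_re, Complex.ofReal_re, Complex.mul_re, Complex.I_re, mul_zero,
              Complex.ofReal_im, Complex.I_im, mul_one, sub_self, add_zero, Complex.add_im,
              Complex.mul_im, zero_add]
            nlinarith
          have hθ4 : y ^ 2 / (x ^ 2 + y ^ 2) / 4 ≤ 1 := by linarith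
          calc Φ₁ (‖f (x + η * Complex.I)‖ / 4)
              ≤ Φ₁ (y ^ 2 / (x ^ 2 + y ^ 2) / 4 * u) :=
                h₁.growth.monotoneOn (mem_Ici.2 (by positivity)) (mem_Ici.2 (by positivity)) hle
            _ ≤ y ^ 2 / (x ^ 2 + y ^ 2) / 4 * Φ₁ u :=
                h₁.map_mul_le (by positivity) hθ4 hu.le
            _ = Real.pi / 4 * poissonKer y x := by
                have hΦy : Φ₁ u = y⁻¹ := by rw [hy_def, inv_inv]
                have hπ := Real.pi_pos
                have : x ^ 2 + y ^ 2 ≠ 0 := by positivity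
                rw [hΦy]
                unfold poissonKer
                field_simp
      _ = ENNReal.ofReal (Real.pi / 4) := by
          rw [lintegral_const_mul' _ _ ENNReal.ofReal_ne_top, lintegral_poissonKer hy, mul_one]
      _ ≤ 1 := ENNReal.ofReal_le_one.2 (by linarith [Real.pi_le_four])
  have hHardy : hardyNorm Φ₁ f ≤ ENNReal.ofReal 4 :=
    iSup₂_le fun η hη => luxNorm_le (by norm_num) (hline η hη)
  have hmem : f ∈ hardyOrlicz Φ₁ := ⟨hfd, hHardy.trans_lt ENNReal.ofReal_lt_top⟩
  have hberg : bergmanNorm α Φ₂ f < ENNReal.ofReal L := by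
    refine (hnorm f hmem).trans_lt ((mul_le_mul_right hHardy _).trans_lt ?_)
    rw [← ENNReal.ofReal_mul hC'.le]
    exact (ENNReal.ofReal_lt_ofReal_iff hL).2 hL4
  have hmod : modular Φ₂ (weightedVolume α) f L ≤ 1 := modular_le_one_of_luxNorm_lt h₂ hberg
  set S := {z : ℂ | z.re ∈ Ioo (-y) y ∧ z.im ∈ Ioo 0 y}
  have hS : MeasurableSet S :=
    (Complex.measurable_re measurableSet_Ioo).inter (Complex.measurable_im measurableSet_Ioo)
  have hΦ₂0 : 0 ≤ Φ₂ (u / (5 * L)) := h₂.nonneg (by positivity)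
  have hbox : ENNReal.ofReal (Φ₂ (u / (5 * L)) * (2 * y * (y ^ (α + 1) / (α + 1)))) ≤
      ENNReal.ofReal 1 := by
    rw [ENNReal.ofReal_mul hΦ₂0, ← weightedVolume_box hα hy, ← lintegral_indicator_const hS,
      ENNReal.ofReal_one]
    refine le_trans (lintegral_mono fun z => ?_) hmod
    by_cases hz : z ∈ S
    · rw [indicator_of_mem hz]
      refine ENNReal.ofReal_le_ofReal (h₂.monotoneOn (mem_Ici.2 (by positivity))
        (mem_Ici.2 (by positivity)) ?_)
      obtain ⟨⟨hz1, hz2⟩, hz3, hz4⟩ := hz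
      rw [← div_div]
      gcongr
      rw [hfn, div_eq_mul_inv]
      gcongr
      rw [le_div_iff₀ (by positivity)]
      nlinarith
    · rw [indicator_of_notMem hz]
      exact zero_le
  rw [ENNReal.ofReal_le_ofReal_iff zero_le_one] at hbox
  have hyp : y * y ^ (α + 1) = (Φ₁ u ^ (2 + α))⁻¹ := by
    rw [← Real.inv_rpow hΦu.le, ← hy_def, show 2 + α = 1 + (α + 1) by ring,
      Real.rpow_add hy 1 (α + 1), Real.rpow_one]
  have hp : 0 < Φ₁ u ^ (2 + α) := Real.rpow_pos_of_pos hΦu _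
  have h3 : Φ₂ (u / (5 * L)) ≤ (α + 1) / 2 * Φ₁ u ^ (2 + α) := by
    have h4 : Φ₂ (u / (5 * L)) * (2 * y * (y ^ (α + 1) / (α + 1))) =
        Φ₂ (u / (5 * L)) / ((α + 1) / 2 * Φ₁ u ^ (2 + α)) := by
      rw [show 2 * y * (y ^ (α + 1) / (α + 1)) = 2 * (y * y ^ (α + 1)) / (α + 1) by ring, hyp]
      field_simp
    rw [h4, div_le_one (by positivity)] at hbox
    exact hbox
  have h5 := hup (u / (5 * L)) (5 * L) (by positivity) (by linarith)
  rw [div_mul_cancel₀ _ (by positivity)] at h5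
  calc Φ₂ u ≤ C₀ * (5 * L) ^ q * Φ₂ (u / (5 * L)) := h5
    _ ≤ C₀ * (5 * L) ^ q * ((α + 1) / 2 * Φ₁ u ^ (2 + α)) := by gcongr
    _ = _ := by ring

end HardyOrlicz

end

theorem theorem2p5 (Φ₁ Φ₂ : ℝ → ℝ) (α : ℝ)
    (hΦ₁ : HardyOrlicz.IsC1ConvexGrowth Φ₁)
    (hΦ₂ : HardyOrlicz.IsC1ConvexGrowth Φ₂)
    (hU : HardyOrlicz.ClassU Φ₂)
    (hα : -1 < α)
    (hnabla : HardyOrlicz.Nabla2 Φ₁)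
    (hmono : MonotoneOn (fun t => Φ₂ t / Φ₁ t) (Set.Ioi 0)) :
    HardyOrlicz.EmbedsContinuously Φ₁ Φ₂ α ↔
      ∃ C : ℝ, 0 < C ∧ ∀ t : ℝ, 0 < t →
        HardyOrlicz.growthInv Φ₁ t ≤ HardyOrlicz.growthInv Φ₂ (C * t ^ (2 + α)) := by
  obtain ⟨q, -, -, hq, -⟩ := hU
  have hpos₁ : ∀ t, 0 < t → 0 < Φ₁ t := fun t => hΦ₁.growth.pos_of_delta2 hnabla.1
  have hpos₂ : ∀ t, 0 < t → 0 < Φ₂ t := fun t => hΦ₂.growth.pos_of_upperType hq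
  have hiff := fun {C : ℝ} (hC : 0 < C) => HardyOrlicz.growthInv_le_iff (r := 2 + α) hC
    hΦ₁.growth hΦ₂.growth (hΦ₁.strictMonoOn hpos₁) (hΦ₂.strictMonoOn hpos₂)
  constructor
  · intro hemb
    obtain ⟨C, hC, h⟩ := HardyOrlicz.exists_le_rpow_of_embedsContinuously hα hΦ₁ hpos₁
      hΦ₂.growth hq hemb
    exact ⟨C, hC, (hiff hC).2 h⟩
  · rintro ⟨C, hC, h⟩
    obtain ⟨a, ha, hsup⟩ := hΦ₁.exists_superlinear hnabla.2
    obtain ⟨K, hK, hd⟩ := hnabla.1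
    have hK0 : 0 < K := by linarith
    have hdouble₁ : ∀ s, 0 < s → Φ₁ s ≤ K * Φ₁ (s / 2) := by
      intro s hs
      have h2 := hpos₁ _ (half_pos hs)
      have h1 := hd (s / 2) (half_pos hs).le
      beta_reduce at h1
      rw [mul_div_cancel₀ s two_ne_zero, ← ENNReal.ofReal_mul hK0.le,
        ENNReal.ofReal_le_ofReal_iff (by positivity)] at h1
      exact h1
    obtain ⟨C₀, hC₀, hup⟩ := id hq
    have hdouble₂ : ∀ s, 0 < s → Φ₂ s ≤ C₀ * 2 ^ q * Φ₂ (s / 2) := by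
      intro s hs
      have h1 := hup (s / 2) 2 (half_pos hs) one_le_two
      rwa [div_mul_cancel₀ s two_ne_zero] at h1
    obtain ⟨M, hM1, hM⟩ := HardyOrlicz.exists_modular_le hα hΦ₁.growth hΦ₂.growth hpos₁
      (fun b t hb hb1 ht => hΦ₁.map_mul_le hb hb1 ht) hK0 hdouble₁ (by positivity) hdouble₂ ha hsup
      hC ((hiff hC).1 h)
    exact HardyOrlicz.embedsContinuously_of_modular_le hΦ₁.growth hΦ₂ hq hM1 hM
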